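/- Consider $K$ parallel data streams. Stream $k$ has a random change point $\tau_k\in\{0,1,2,\dots\}\cup\{\infty\}$ and observations $X_{k,t}$, $t=1,2,\dots$. The vector $(\tau_1,\dots,\tau_K)$ has an arbitrary joint distribution and, given $(\tau_1,\dots,\tau_K)$, the $X_{k,t}$ are independent over all $k$ and $t$, where $X_{k,t}$ has density $p_{k,t}$ if $t\le\tau_k$ and density $q_{k,t}$ if $t>\tau_k$, with respect to a baseline measure $\mu$ (the general model). Model $\mathcal M_{\mathrm s}$ is the special case in which $\tau_1,\dots,\tau_K$ are i.i.d. with $\mathbb P(\tau_k=m)=\theta(1-\theta)^m$, $m=0,1,\dots$, for some $\theta\in(0,1)$, and $p_{k,t}=p$, $q_{k,t}=q$ do not depend on $k,t$. A sequential procedure $\mathbb T$ is a process of active index sets $S_1\supseteq S_2\supseteq\cdots$ with $S_1=\{1,\dots,K\}$ such that, for every $t\ge1$, $S_{t+1}$ is $\mathcal F_t$-measurable, where $\mathcal F_1=\sigma(X_{k,1},\,1\le k\le K)$ and $\mathcal F_t=\sigma(\mathcal F_{t-1},S_t,X_{k,t},k\in S_t)$ for $t>1$. For $\alpha\in(0,1]$,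 $\mathcal T_\alpha$ is the class of procedures with $\mathrm{LFNR}_t(\mathbb T)\le\alpha$ a.s. for all $t\ge1$, where $\mathrm{LFNR}_1=0$ and $$\mathrm{LFNR}_{t+1}(\mathbb T)=\mathbb E\Big[\frac{\sum_{k\in S_{t+1}}\mathbf 1(\tau_k<t)}{\max(|S_{t+1}|,1)}\,\Big|\,\mathcal F_t\Big],\qquad t\ge 1 .$$ The utilization of $\mathbb T$ is $\mathrm U_t(\mathbb T)=\sum_{s=1}^t|S_s|$. One-step update rule: given $S_t$ and $W_{k,t}=\mathbb P(\tau_k<t\mid\mathcal F_t)$, list $S_t=\{k_1,\dots,k_{|S_t|}\}$ by ascending $W_{k,t}$, ties being broken by ascending index; put $R_0=0$ and $R_n=\frac1n\sum_{i=1}^nW_{k_i,t}$; let $n$ be the largest element of $\{0,\dots,|S_t|\}$ with $R_n\le\alpha$; set $S_{t+1}=\{k_1,\dots,k_n\}$. The proposed procedure $\mathbb T^*$ starts from $S_1=\{1,\dots,K\}$ and applies this rule at every step. For a procedure $\mathbb T^{A}$ and $t_0\ge0$, the switching procedure $\mathbb T^{G(t_0)}$ has the same active sets as $\mathbb T^{A}$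 at times $1,\dots,t_0$ and obtains each active set from time $t_0+1$ onwards by the one-step update rule, with $S_1=\{1,\dots,K\}$ (so that $\mathbb T^{G(0)}=\mathbb T^*$). Theorem. Let $\alpha\in(0,1]$, $\mathbb T^A\in\mathcal T_\alpha$ and $t_0\ge0$. Then, under the general model, $\mathbb T^{G(t_0)}\in\mathcal T_\alpha$ and $\mathbb T^{G(t_0+1)}\in\mathcal T_\alpha$. Moreover, under model $\mathcal M_{\mathrm s}$, for all $t=1,2,\dots$, $$\mathbb E\,\mathrm U_t(\mathbb T^A)\le\mathbb E\,\mathrm U_t(\mathbb T^{G(t_0+1)})\le\mathbb E\,\mathrm U_t(\mathbb T^{G(t_0)})\le\mathbb E\,\mathrm U_t(\mathbb T^*).$$ -/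

import Mathlib

open MeasureTheory ProbabilityTheory
open scoped ENNReal

namespace CompoundDetection

noncomputable section

/-! ### The Bayesian change-point model

Streams are indexed by `Fin K`, times are `1, 2, 3, …` (the index `0` of a time-indexed family of
observations is never used), and change points take values in `{0, 1, 2, …} ∪ {∞}`. -/

/-- `f` is a probability density with respect to the baseline measure `μ`. -/
def IsDensity {E : Type*} [MeasurableSpace E] (μ : Measure E) (f : E → ℝ≥0∞) : Prop :=
  Measurable f ∧ ∫⁻ x, f x ∂μ = 1

/-- The law of an observation at time `t` in a stream whose change point is `m`: density `p` if
`t ≤ m`, density `q` if `t > m`. -/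
def obsLaw {E : Type*} [MeasurableSpace E] (μ : Measure E) (p q : E → ℝ≥0∞) (m : ℕ∞) (t : ℕ) :
    Measure E :=
  if (t : ℕ∞) ≤ m then μ.withDensity p else μ.withDensity q

/-- The general change-point model: given the change points `(τ 1, …, τ K)`, whose joint law is
arbitrary, the observations `X k t` are independent over all `k` and all `t ≥ 1`, and `X k t` has
density `p k t` if `t ≤ τ k` and density `q k t` if `t > τ k`. As `(τ 1, …, τ K)` has countably
many values `m`, the conditional law of the observations is given by its values on the
events `τ = m`. -/
structure IsChangePointModel {Ω E : Type*} [MeasurableSpace Ω] [MeasurableSpace E] {K : ℕ}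
    (P : Measure Ω) (μ : Measure E) (p q : Fin K → ℕ → E → ℝ≥0∞)
    (τ : Fin K → Ω → ℕ∞) (X : Fin K → ℕ → Ω → E) : Prop where
  density_pre : ∀ k t, 1 ≤ t → IsDensity μ (p k t)
  density_post : ∀ k t, 1 ≤ t → IsDensity μ (q k t)
  measurable_changePoint : ∀ k, Measurable (τ k)
  measurable_obs : ∀ k t, 1 ≤ t → Measurable (X k t)
  joint_law : ∀ (m : Fin K → ℕ∞) (n : ℕ) (B : Fin K → ℕ → Set E),
    (∀ k t, MeasurableSet (B k t)) →
    P {ω | (∀ k, τ k ω = m k) ∧ ∀ k, ∀ t ∈ Finset.Icc 1 n, X k t ω ∈ B k t} =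
      P {ω | ∀ k, τ k ω = m k} *
        ∏ k, ∏ t ∈ Finset.Icc 1 n, obsLaw μ (p k t) (q k t) (m k) t (B k t)

/-- The i.i.d. change-point model `𝓜ₛ`: the change points are i.i.d. geometric with parameter
`θ ∈ (0,1)`, and the pre- and post-change densities are the same for all streams and times. -/
structure IsModelMs {Ω E : Type*} [MeasurableSpace Ω] [MeasurableSpace E] {K : ℕ}
    (P : Measure Ω) (μ : Measure E) (p q : Fin K → ℕ → E → ℝ≥0∞)
    (τ : Fin K → Ω → ℕ∞) (X : Fin K → ℕ → Ω → E) (θ : ℝ) : Prop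
    extends IsChangePointModel P μ p q τ X where
  theta_mem : θ ∈ Set.Ioo (0 : ℝ) 1
  indep : iIndepFun τ P
  geometric : ∀ k (m : ℕ), P {ω | τ k ω = m} = ENNReal.ofReal (θ * (1 - θ) ^ m)
  homogeneous_pre : ∃ p₀ : E → ℝ≥0∞, ∀ k t, 1 ≤ t → p k t = p₀
  homogeneous_post : ∃ q₀ : E → ℝ≥0∞, ∀ k t, 1 ≤ t → q k t = q₀

/-! ### Sequential procedures

A procedure is represented by its process `S` of active index sets, `S t ω ⊆ {1, …, K}` for
`t = 1, 2, …`; the value `S 0` is never used. -/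

/-- `σ(S_t, X_{k,t}, k ∈ S_t)`, the information collected at time `t` when the active set is `S`. -/
@[reducible] def obsField {Ω E : Type*} [MeasurableSpace E] {K : ℕ} (X : Fin K → ℕ → Ω → E)
    (S : Ω → Finset (Fin K)) (t : ℕ) : MeasurableSpace Ω :=
  MeasurableSpace.comap S ⊤ ⊔
    MeasurableSpace.generateFrom
      {A | ∃ (k : Fin K) (B : Set E), MeasurableSet B ∧ A = {ω | k ∈ S ω ∧ X k t ω ∈ B}}

/-- The information filtration `𝓕_t = σ(𝓕_{t-1}, S_t, X_{k,t}, k ∈ S_t)`, with `𝓕_0` trivial. -/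
@[reducible] def infoField {Ω E : Type*} [MeasurableSpace E] {K : ℕ} (X : Fin K → ℕ → Ω → E)
    (S : ℕ → Ω → Finset (Fin K)) : ℕ → MeasurableSpace Ω
  | 0 => ⊥
  | t + 1 => infoField X S t ⊔ obsField X (S (t + 1)) (t + 1)

/-- `S` is a compound sequential detection procedure: all streams are active at time `1`, a stream
is never re-activated, and the active set at time `t + 1` is `𝓕_t`-measurable. -/
structure IsProcedure {Ω E : Type*} [MeasurableSpace E] {K : ℕ} (X : Fin K → ℕ → Ω → E)
    (S : ℕ → Ω → Finset (Fin K)) : Prop where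
  init : ∀ ω, S 1 ω = Finset.univ
  antitone : ∀ t, 1 ≤ t → ∀ ω, S (t + 1) ω ⊆ S t ω
  measurable : ∀ t, 1 ≤ t → ∀ s : Finset (Fin K), MeasurableSet[infoField X S t] {ω | S (t + 1) ω = s}

open Classical in
/-- `FNP_{t+1} = #{k ∈ S_{t+1} : τ_k < t} / max(|S_{t+1}|, 1)`. For `t = 0` this is `FNP_1 = 0`. -/
def fnpSucc {Ω : Type*} {K : ℕ} (τ : Fin K → Ω → ℕ∞) (S : ℕ → Ω → Finset (Fin K)) (t : ℕ)
    (ω : Ω) : ℝ :=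
  ((S (t + 1) ω).filter (fun k => τ k ω < (t : ℕ∞))).card / max ((S (t + 1) ω).card : ℝ) 1

/-- `LFNR_{t+1} = E(FNP_{t+1} | 𝓕_t)`. For `t = 0` this is `LFNR_1 = 0`. -/
def lfnrSucc {Ω E : Type*} [MeasurableSpace Ω] [MeasurableSpace E] {K : ℕ} (P : Measure Ω)
    (τ : Fin K → Ω → ℕ∞) (X : Fin K → ℕ → Ω → E) (S : ℕ → Ω → Finset (Fin K)) (t : ℕ) : Ω → ℝ :=
  P[fnpSucc τ S t | infoField X S t]

/-- The class `𝓣_α` of procedures with `LFNR_t ≤ α` almost surely for all `t = 1, 2, …`. -/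
def procedureClass {Ω E : Type*} [MeasurableSpace Ω] [MeasurableSpace E] {K : ℕ} (P : Measure Ω)
    (τ : Fin K → Ω → ℕ∞) (X : Fin K → ℕ → Ω → E) (α : ℝ) : Set (ℕ → Ω → Finset (Fin K)) :=
  {S | IsProcedure X S ∧ ∀ t, ∀ᵐ ω ∂P, lfnrSucc P τ X S t ω ≤ α}

/-- The stream utilization `U_t = ∑_{s=1}^t |S_s|`. -/
def utilization {Ω : Type*} {K : ℕ} (S : ℕ → Ω → Finset (Fin K)) (t : ℕ) (ω : Ω) : ℝ :=
  ∑ s ∈ Finset.Icc 1 t, ((S s ω).card : ℝ)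

/-! ### The one-step update rule and the procedures built from it -/

/-- The first `n` elements `k_1, …, k_n` of `S` when `S` is sorted by ascending value of `w`, ties
being broken by ascending index: the elements of `S` with fewer than `n` predecessors. -/
def firstElems {K : ℕ} (S : Finset (Fin K)) (w : Fin K → ℝ) (n : ℕ) : Finset (Fin K) :=
  S.filter (fun k => (S.filter (fun j => toLex (w j, j) < toLex (w k, k))).card < n)

open Classical in
/-- The one-step update rule: with `R_n = (w_{k_1} + ⋯ + w_{k_n}) / n` and `R_0 = 0`, it returns
`{k_1, …, k_n}` for the largest `n ∈ {0, …, |S|}` such that `R_n ≤ α`. -/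
def updateRule {K : ℕ} (α : ℝ) (S : Finset (Fin K)) (w : Fin K → ℝ) : Finset (Fin K) :=
  firstElems S w
    (Nat.findGreatest (fun n => (∑ k ∈ firstElems S w n, w k) / (n : ℝ) ≤ α) S.card)

/-- The posterior probability `W_{k,t} = P(τ_k < t | 𝓕)` given the information `𝓕`. -/
def postProb {Ω : Type*} {K : ℕ} (F : MeasurableSpace Ω) [MeasurableSpace Ω] (P : Measure Ω)
    (τ : Fin K → Ω → ℕ∞) (t : ℕ) (k : Fin K) : Ω → ℝ :=
  P⟦{ω | τ k ω < (t : ℕ∞)} | F⟧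

/-- The active set at time `t + 1` given by the one-step update rule, when the active set at time
`t` is `S` and the information at time `t` is `F`. -/
def nextSet {Ω : Type*} {K : ℕ} (F : MeasurableSpace Ω) [MeasurableSpace Ω] (P : Measure Ω)
    (τ : Fin K → Ω → ℕ∞) (α : ℝ) (S : Ω → Finset (Fin K)) (t : ℕ) (ω : Ω) : Finset (Fin K) :=
  updateRule α (S ω) (fun k => postProb F P τ t k ω)

/-- The active set and the information at time `t` under the proposed procedure `T*`: all streams
are active at time `1`, and every later active set is given by the one-step update rule. -/
def proposedState {Ω E : Type*} [MeasurableSpace Ω] [MeasurableSpace E] {K : ℕ} (P : Measure Ω)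
    (τ : Fin K → Ω → ℕ∞) (X : Fin K → ℕ → Ω → E) (α : ℝ) :
    ℕ → (Ω → Finset (Fin K)) × MeasurableSpace Ω
  | 0 => (fun _ => Finset.univ, ⊥)
  | t + 1 =>
    let prev := proposedState P τ X α t
    let S := if t = 0 then fun _ => Finset.univ else nextSet prev.2 P τ α prev.1 t
    (S, prev.2 ⊔ obsField X S (t + 1))

/-- The proposed procedure `T*`. -/
def proposed {Ω E : Type*} [MeasurableSpace Ω] [MeasurableSpace E] {K : ℕ} (P : Measure Ω)
    (τ : Fin K → Ω → ℕ∞) (X : Fin K → ℕ → Ω → E) (α : ℝ) (t : ℕ) : Ω → Finset (Fin K) :=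
  (proposedState P τ X α t).1

/-- The active set and the information at time `t` under the procedure which follows the procedure
`A` at times `1, …, t₀` and the one-step update rule from time `t₀ + 1` onwards. -/
def switchState {Ω E : Type*} [MeasurableSpace Ω] [MeasurableSpace E] {K : ℕ} (P : Measure Ω)
    (τ : Fin K → Ω → ℕ∞) (X : Fin K → ℕ → Ω → E) (α : ℝ) (A : ℕ → Ω → Finset (Fin K)) (t₀ : ℕ) :
    ℕ → (Ω → Finset (Fin K)) × MeasurableSpace Ω
  | 0 => (fun _ => Finset.univ, ⊥)
  | t + 1 =>
    let prev := switchState P τ X α A t₀ t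
    let S := if t = 0 then fun _ => Finset.univ
      else if t + 1 ≤ t₀ then A (t + 1)
      else nextSet prev.2 P τ α prev.1 t
    (S, prev.2 ⊔ obsField X S (t + 1))

/-- The switching procedure `T^{G(t₀)}` built from `A`. -/
def switching {Ω E : Type*} [MeasurableSpace Ω] [MeasurableSpace E] {K : ℕ} (P : Measure Ω)
    (τ : Fin K → Ω → ℕ∞) (X : Fin K → ℕ → Ω → E) (α : ℝ) (A : ℕ → Ω → Finset (Fin K)) (t₀ : ℕ)
    (t : ℕ) : Ω → Finset (Fin K) :=
  (switchState P τ X α A t₀ t).1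

/-- The information used by `T*` is its own information filtration. -/
theorem proposedState_snd {Ω E : Type*} [MeasurableSpace Ω] [MeasurableSpace E] {K : ℕ}
    (P : Measure Ω) (τ : Fin K → Ω → ℕ∞) (X : Fin K → ℕ → Ω → E) (α : ℝ) (t : ℕ) :
    (proposedState P τ X α t).2 = infoField X (proposed P τ X α) t := by
  induction t with
  | zero => rfl
  | succ t ih => rw [infoField, ← ih]; rfl

/-- The information used by a switching procedure is its own information filtration. -/
theorem switchState_snd {Ω E : Type*} [MeasurableSpace Ω] [MeasurableSpace E] {K : ℕ}
    (P : Measure Ω) (τ : Fin K → Ω → ℕ∞) (X : Fin K → ℕ → Ω → E) (α : ℝ)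
    (A : ℕ → Ω → Finset (Fin K)) (t₀ t : ℕ) :
    (switchState P τ X α A t₀ t).2 = infoField X (switching P τ X α A t₀) t := by
  induction t with
  | zero => rfl
  | succ t ih => rw [infoField, ← ih]; rfl

end

end CompoundDetection

/-! Membership in the class rests on one identity: as $S_{t+1}$ is $\mathcal F_t$-measurable, LFNR
is the average posterior probability over the kept streams (`lfnrSucc_ae_eq`). Before the switch
this is the average for `A`; after it, the update rule keeps the average at most $\alpha$.

For the utilizations it is enough that $\mathbb E|S_t|$ under $\mathbb T^{G(n)}$ is antitone in $n$,
for each $t$: `A` coincides with $\mathbb T^{G(n)}$ up to time $n$, and $\mathbb T^*$ is $\mathbb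
T^{G(0)}$. The procedures $G(s)$ and $G(s+1)$ differ first at time $s+1$, where one applies the
update rule and the other the choice of `A`; afterwards both apply the rule. So one greedy choice
has to be compared with one admissible choice, both followed greedily.

Under $\mathcal M_{\mathrm s}$ the streams are independent, so the posterior probability of an
active stream depends only on its own past, all of which has been observed. It therefore equals the
posterior given the observations of all streams, active or not (`IsRatioModel.postProb_ae_eq`). The
vector of these full posteriors is a Markov chain with independent, identically driven coordinates
(`IsRatioModel.lintegral_predict`), and under greedy continuation the expected number of active
streams is a function `value` of the selected set and this vector (`IsRatioModel.lintegral_card`).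

States are ordered by `Dominated`: an injective matching of the streams that does not increase
posteriors. The update rule dominates every admissible choice and preserves the order
(`dominated_updateRule`, `Dominated.updateRule`), and a larger posterior now makes the next one
stochastically larger (`IsRatio.lintegral_bayes_anti`). Hence `value` is monotone in this order
(`value_mono`), which gives the comparison. -/

namespace CompoundDetection

/-! ### Combinatorics of the one-step update rule -/

section Combinatorics

variable {K : ℕ}

/-- The number of elements of `S` which precede `k` in the order used by `firstElems`. -/
noncomputable def rankIn (S : Finset (Fin K)) (w : Fin K → ℝ) (k : Fin K) : ℕ :=
  (S.filter (fun j => toLex (w j, j) < toLex (w k, k))).card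

theorem mem_firstElems {S : Finset (Fin K)} {w : Fin K → ℝ} {n : ℕ} {k : Fin K} :
    k ∈ firstElems S w n ↔ k ∈ S ∧ rankIn S w k < n := by
  simp [firstElems, rankIn]

theorem firstElems_subset (S : Finset (Fin K)) (w : Fin K → ℝ) (n : ℕ) : firstElems S w n ⊆ S :=
  Finset.filter_subset _ _

theorem firstElems_mono (S : Finset (Fin K)) (w : Fin K → ℝ) {m n : ℕ} (h : m ≤ n) :
    firstElems S w m ⊆ firstElems S w n := fun _ hk =>
  mem_firstElems.2 ⟨(mem_firstElems.1 hk).1, (mem_firstElems.1 hk).2.trans_le h⟩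

theorem rankIn_lt_of_lt {S : Finset (Fin K)} {w : Fin K → ℝ} {j k : Fin K} (hj : j ∈ S)
    (h : toLex (w j, j) < toLex (w k, k)) : rankIn S w j < rankIn S w k := by
  refine Finset.card_lt_card (Finset.ssubset_iff_of_subset ?_ |>.2 ⟨j, by simp [hj, h], by simp⟩)
  intro i hi
  simp only [Finset.mem_filter] at hi ⊢
  exact ⟨hi.1, hi.2.trans h⟩

/-- Breaking ties by index makes the keys distinct even when values of `w` coincide, so ranks number
the elements of `S` without repetition. -/
theorem rankIn_injOn (S : Finset (Fin K)) (w : Fin K → ℝ) : Set.InjOn (rankIn S w) S := by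
  intro j hj k hk h
  rcases lt_trichotomy (toLex (w j, j)) (toLex (w k, k)) with h1 | h1 | h1
  · exact absurd h (rankIn_lt_of_lt hj h1).ne
  · exact (Prod.ext_iff.1 (toLex.injective h1)).2
  · exact absurd h (rankIn_lt_of_lt hk h1).ne'

theorem rankIn_lt_card {S : Finset (Fin K)} (w : Fin K → ℝ) {k : Fin K} (hk : k ∈ S) :
    rankIn S w k < S.card :=
  Finset.card_lt_card (Finset.ssubset_iff_of_subset (Finset.filter_subset _ _) |>.2
    ⟨k, hk, by simp⟩)

theorem image_rankIn (S : Finset (Fin K)) (w : Fin K → ℝ) :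
    S.image (rankIn S w) = Finset.range S.card := by
  refine Finset.eq_of_subset_of_card_le ?_ ?_
  · intro n hn
    obtain ⟨k, hk, rfl⟩ := Finset.mem_image.1 hn
    exact Finset.mem_range.2 (rankIn_lt_card w hk)
  · rw [Finset.card_range, Finset.card_image_of_injOn (rankIn_injOn S w)]

theorem card_firstElems {S : Finset (Fin K)} (w : Fin K → ℝ) {n : ℕ} (hn : n ≤ S.card) :
    (firstElems S w n).card = n := by
  have h : (firstElems S w n).image (rankIn S w) = Finset.range n := by
    ext m
    simp only [Finset.mem_image, mem_firstElems, Finset.mem_range]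
    constructor
    · rintro ⟨k, ⟨-, hk⟩, rfl⟩
      exact hk
    · intro hm
      have : m ∈ S.image (rankIn S w) := by
        rw [image_rankIn]
        exact Finset.mem_range.2 (hm.trans_le hn)
      obtain ⟨k, hk, rfl⟩ := Finset.mem_image.1 this
      exact ⟨k, ⟨hk, hm⟩, rfl⟩
  have hinj : Set.InjOn (rankIn S w) (firstElems S w n) :=
    (rankIn_injOn S w).mono (by exact_mod_cast firstElems_subset S w n)
  rw [← Finset.card_image_of_injOn hinj, h, Finset.card_range]

theorem le_of_mem_firstElems_of_notMem {S : Finset (Fin K)} {w : Fin K → ℝ} {n : ℕ}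
    {j k : Fin K} (hj : j ∈ firstElems S w n) (hk : k ∈ S) (hk' : k ∉ firstElems S w n) :
    w j ≤ w k := by
  rw [mem_firstElems] at hj hk'
  have hlt : rankIn S w j < rankIn S w k := by
    by_contra h
    exact hk' ⟨hk, (not_lt.1 h).trans_lt hj.2⟩
  by_contra h
  have : toLex (w k, k) < toLex (w j, j) := by
    rw [Prod.Lex.toLex_lt_toLex]
    exact Or.inl (not_le.1 h)
  exact absurd (rankIn_lt_of_lt hk this) hlt.not_gt

/-- A set of elements of `S` can be matched with the first elements of `S`, with no increase of the
values. -/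
theorem exists_injOn_firstElems {S C : Finset (Fin K)} (w : Fin K → ℝ) (hC : C ⊆ S) :
    ∃ e : Fin K → Fin K, Set.InjOn e C ∧ ∀ c ∈ C, e c ∈ firstElems S w C.card ∧ w (e c) ≤ w c := by
  classical
  set F := firstElems S w C.card with hF
  have hFc : F.card = C.card := card_firstElems w (Finset.card_le_card hC)
  -- Common elements stay fixed. The others may be matched by any bijection, since every element of
  -- `F` has a value at most that of any element of `S` outside `F`.
  have hcard : (C \ F).card = (F \ C).card := by
    have h1 := Finset.card_sdiff_add_card_inter C F
    have h2 := Finset.card_sdiff_add_card_inter F C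
    rw [Finset.inter_comm F C] at h2
    omega
  let g := Finset.equivOfCardEq hcard
  let e : Fin K → Fin K := fun c => if h : c ∈ C \ F then (g ⟨c, h⟩ : Fin K) else c
  have he : ∀ c (h : c ∈ C \ F), e c = (g ⟨c, h⟩ : Fin K) := fun c h => dif_pos h
  have he' : ∀ c, c ∉ C \ F → e c = c := fun c h => dif_neg h
  have hmem : ∀ c (h : c ∈ C \ F), e c ∈ F \ C := fun c h => by
    rw [he c h]
    exact (g ⟨c, h⟩).2
  refine ⟨e, ?_, ?_⟩
  · intro a ha b hb hab
    by_cases h1 : a ∈ C \ F <;> by_cases h2 : b ∈ C \ F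
    · rw [he a h1, he b h2] at hab
      simpa using g.injective (Subtype.ext hab)
    · have := hmem a h1
      rw [hab, he' b h2] at this
      exact absurd hb (Finset.mem_sdiff.1 this).2
    · have := hmem b h2
      rw [← hab, he' a h1] at this
      exact absurd ha (Finset.mem_sdiff.1 this).2
    · rwa [he' a h1, he' b h2] at hab
  · intro c hc
    by_cases h : c ∈ C \ F
    · have h1 := (Finset.mem_sdiff.1 (hmem c h)).1
      exact ⟨h1, le_of_mem_firstElems_of_notMem h1 (hC hc) (Finset.mem_sdiff.1 h).2⟩
    · rw [he' c h]
      exact ⟨by_contra fun h' => h (Finset.mem_sdiff.2 ⟨hc, h'⟩), le_rfl⟩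

/-- `Dominated B v' S v` says that the values of `v` on `S` are better than those of `v'` on `B`:
there are at least as many of them, and they are smaller. -/
def Dominated (B : Finset (Fin K)) (v' : Fin K → ℝ) (S : Finset (Fin K)) (v : Fin K → ℝ) : Prop :=
  ∃ e : Fin K → Fin K, Set.InjOn e B ∧ ∀ k ∈ B, e k ∈ S ∧ v (e k) ≤ v' k

theorem Dominated.card_le {B S : Finset (Fin K)} {v' v : Fin K → ℝ} (h : Dominated B v' S v) :
    B.card ≤ S.card := by
  obtain ⟨e, he, h⟩ := h
  exact Finset.card_le_card_of_injOn e (fun k hk => (h k hk).1) he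

/-- With the matching extended to all streams, domination becomes a coordinatewise comparison of
`v'` with the relabelled vector `v ∘ σ`. Exchangeability of the streams then removes the relabelling
in `value_mono`. -/
theorem Dominated.exists_perm {B S : Finset (Fin K)} {v' v : Fin K → ℝ} (h : Dominated B v' S v) :
    ∃ σ : Equiv.Perm (Fin K), ∀ k ∈ B, σ k ∈ S ∧ v (σ k) ≤ v' k := by
  classical
  obtain ⟨e, he, h⟩ := h
  obtain ⟨g, hg⟩ := Finset.exists_equiv_extend_of_card_eq (α := Fin K) (β := Fin K)
    (t := Finset.univ) (by simp) (s := B) (f := e) (Finset.subset_univ _) he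
  refine ⟨g.trans (Equiv.subtypeUnivEquiv (fun x => Finset.mem_univ x)), fun k hk => ?_⟩
  simpa [hg k hk] using h k hk

theorem updateRule_subset (α : ℝ) (S : Finset (Fin K)) (w : Fin K → ℝ) : updateRule α S w ⊆ S :=
  firstElems_subset _ _ _

open Classical in
theorem updateRule_avg_le {α : ℝ} (hα : 0 ≤ α) (S : Finset (Fin K)) (w : Fin K → ℝ) :
    (∑ k ∈ updateRule α S w, w k) / max ((updateRule α S w).card : ℝ) 1 ≤ α := by
  set p : ℕ → Prop := fun n => (∑ k ∈ firstElems S w n, w k) / (n : ℝ) ≤ α with hp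
  have hU : updateRule α S w = firstElems S w (Nat.findGreatest p S.card) := by
    simp only [updateRule, hp]
  set n := Nat.findGreatest p S.card with hn
  -- `n = 0` always qualifies: division by zero gives the convention $R_0 = 0$, and `0 ≤ α`.
  have hpn : p n := Nat.findGreatest_spec (P := p) (m := 0) (Nat.zero_le _) (by simp [hp, hα])
  have hc : (updateRule α S w).card = n := by
    rw [hU]
    exact card_firstElems w (Nat.findGreatest_le _)
  rcases Nat.eq_zero_or_pos n with h0 | h0
  · rw [h0, Finset.card_eq_zero] at hc
    simp [hc, hα]
  · rw [hc, hU, max_eq_left (by exact_mod_cast h0)]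
    exact hpn

-- Since the rule takes the largest admissible `n`, monotonicity of $R_n$ plays no role.
open Classical in
theorem firstElems_subset_updateRule {α : ℝ} {S : Finset (Fin K)} {w : Fin K → ℝ} {n : ℕ}
    (hn : n ≤ S.card) (h : (∑ k ∈ firstElems S w n, w k) / (n : ℝ) ≤ α) :
    firstElems S w n ⊆ updateRule α S w := by
  refine firstElems_mono S w (Nat.le_findGreatest hn ?_)
  exact h

/-- The update rule is optimal: it dominates every admissible choice of streams from a state which is
no better. -/
theorem dominated_updateRule {α : ℝ} (hα : 0 ≤ α) {B S : Finset (Fin K)} {v' v : Fin K → ℝ}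
    (h : Dominated B v' S v) (hB : (∑ k ∈ B, v' k) / max (B.card : ℝ) 1 ≤ α) :
    Dominated B v' (updateRule α S v) v := by
  classical
  obtain ⟨σ, hσ, h⟩ := h
  have hCS : B.image σ ⊆ S := by
    intro x hx
    obtain ⟨k, hk, rfl⟩ := Finset.mem_image.1 hx
    exact (h k hk).1
  obtain ⟨e, he, he'⟩ := exists_injOn_firstElems v hCS
  have hcard : (B.image σ).card = B.card := Finset.card_image_of_injOn hσ
  have hle : B.card ≤ S.card := hcard ▸ Finset.card_le_card hCS
  rw [hcard] at he'
  have hinj : Set.InjOn (fun k => e (σ k)) B := by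
    intro a ha b hb hab
    exact hσ ha hb (he (by simpa using ⟨a, ha, rfl⟩) (by simpa using ⟨b, hb, rfl⟩) hab)
  have hmem : ∀ k ∈ B, e (σ k) ∈ firstElems S v B.card ∧ v (e (σ k)) ≤ v' k := fun k hk =>
    have := he' (σ k) (Finset.mem_image_of_mem σ hk)
    ⟨this.1, this.2.trans (h k hk).2⟩
  -- The matching fills the whole initial segment of length `B.card`. The sum over that segment is
  -- then at most the sum over `B`, so $R_{|B|}\le\alpha$ and the rule keeps the entire segment.
  have himg : B.image (fun k => e (σ k)) = firstElems S v B.card := by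
    refine Finset.eq_of_subset_of_card_le ?_ ?_
    · intro x hx
      obtain ⟨k, hk, rfl⟩ := Finset.mem_image.1 hx
      exact (hmem k hk).1
    · rw [Finset.card_image_of_injOn hinj, card_firstElems v hle]
  have hsum : ∑ k ∈ firstElems S v B.card, v k ≤ ∑ k ∈ B, v' k := by
    rw [← himg, Finset.sum_image hinj]
    exact Finset.sum_le_sum fun k hk => (hmem k hk).2
  have hsub : firstElems S v B.card ⊆ updateRule α S v := by
    refine firstElems_subset_updateRule hle ?_
    rcases Nat.eq_zero_or_pos B.card with h0 | h0
    · simp [h0, hα]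
    · rw [max_eq_left (by exact_mod_cast h0)] at hB
      exact (by gcongr : _ ≤ _).trans hB
  exact ⟨fun k => e (σ k), hinj, fun k hk => ⟨hsub (hmem k hk).1, (hmem k hk).2⟩⟩

theorem Dominated.refl (S : Finset (Fin K)) (v : Fin K → ℝ) : Dominated S v S v :=
  ⟨id, Function.injective_id.injOn, fun _ hk => ⟨hk, le_rfl⟩⟩

theorem Dominated.mono_left {B B' S : Finset (Fin K)} {v' v : Fin K → ℝ} (h : Dominated B v' S v)
    (hB : B' ⊆ B) : Dominated B' v' S v := by
  obtain ⟨e, he, h⟩ := h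
  exact ⟨e, he.mono (by exact_mod_cast hB), fun k hk => h k (hB hk)⟩

/-- The rule's own selection from the worse state is an admissible choice, so it is covered by
`dominated_updateRule`. -/
theorem Dominated.updateRule {α : ℝ} (hα : 0 ≤ α) {B S : Finset (Fin K)} {v' v : Fin K → ℝ}
    (h : Dominated B v' S v) :
    Dominated (updateRule α B v') v' (CompoundDetection.updateRule α S v) v :=
  dominated_updateRule hα (h.mono_left (updateRule_subset _ _ _)) (updateRule_avg_le hα _ _)

/-! ### Measurability of the update rule -/

theorem measurableSet_eq_finset {Ω : Type*} [MeasurableSpace Ω] {f : Ω → Finset (Fin K)}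
    (h : ∀ k, MeasurableSet {ω | k ∈ f ω}) (s : Finset (Fin K)) : MeasurableSet {ω | f ω = s} := by
  have : {ω | f ω = s} = ⋂ k, {ω | k ∈ f ω ↔ k ∈ s} := by
    ext ω
    simp [Finset.ext_iff]
  rw [this]
  refine MeasurableSet.iInter fun k => ?_
  by_cases hk : k ∈ s
  · simpa [hk] using h k
  · simp only [hk, iff_false]
    exact (h k).compl

theorem measurableSet_mem_firstElems (S : Finset (Fin K)) (n : ℕ) (k : Fin K) :
    MeasurableSet {w : Fin K → ℝ | k ∈ firstElems S w n} := by
  have hlt : ∀ j : Fin K, MeasurableSet {w : Fin K → ℝ | toLex (w j, j) < toLex (w k, k)} := by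
    intro j
    simp only [Prod.Lex.toLex_lt_toLex]
    exact (measurableSet_lt (measurable_pi_apply j) (measurable_pi_apply k)).union
      ((measurableSet_eq_fun (measurable_pi_apply j) (measurable_pi_apply k)).inter
        (MeasurableSet.const _))
  have hrank : Measurable fun w : Fin K → ℝ => rankIn S w k := by
    simp only [rankIn, Finset.card_filter]
    exact Finset.measurable_fun_sum _ fun j _ =>
      Measurable.ite (hlt j) measurable_const measurable_const
  simp only [mem_firstElems]
  exact (MeasurableSet.const _).inter (measurableSet_lt hrank measurable_const)

theorem measurableSet_updateRule_eq (α : ℝ) (S T : Finset (Fin K)) :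
    MeasurableSet {w : Fin K → ℝ | updateRule α S w = T} := by
  classical
  have hF : ∀ n (U : Finset (Fin K)), MeasurableSet {w : Fin K → ℝ | firstElems S w n = U} :=
    fun n => measurableSet_eq_finset (measurableSet_mem_firstElems S n)
  have hp : ∀ n : ℕ,
      MeasurableSet {w : Fin K → ℝ | (∑ k ∈ firstElems S w n, w k) / (n : ℝ) ≤ α} := by
    intro n
    have : {w : Fin K → ℝ | (∑ k ∈ firstElems S w n, w k) / (n : ℝ) ≤ α} =
        ⋃ U : Finset (Fin K), {w | firstElems S w n = U} ∩ {w | (∑ k ∈ U, w k) / (n : ℝ) ≤ α} := by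
      ext w
      simp
    rw [this]
    exact MeasurableSet.iUnion fun U => (hF n U).inter
      (measurableSet_le (by fun_prop) measurable_const)
  have hN : Measurable fun w : Fin K → ℝ => Nat.findGreatest
      (fun n => (∑ k ∈ firstElems S w n, w k) / (n : ℝ) ≤ α) S.card :=
    measurable_findGreatest fun n _ => hp n
  have : {w : Fin K → ℝ | updateRule α S w = T} = ⋃ n : ℕ,
      {w | Nat.findGreatest (fun n => (∑ k ∈ firstElems S w n, w k) / (n : ℝ) ≤ α) S.card = n} ∩
        {w | firstElems S w n = T} := by
    ext w
    simp only [Set.mem_ofPred_eq, Set.mem_iUnion, Set.mem_inter_iff, exists_eq_left']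
    unfold updateRule
    rfl
  rw [this]
  exact MeasurableSet.iUnion fun n => (measurableSet_eq_fun hN measurable_const).inter (hF n T)

end Combinatorics

/-! ### One step of the Bayesian filter

`ν_p` and `ν_q` are the pre- and post-change laws, and `r` is the density of `ν_q` with respect to
`ν = ν_p + ν_q`. -/

section Filter

/-- The probability that the change has occurred one step later, when it is now `v`. -/
noncomputable def prior (θ v : ℝ) : ℝ := v + θ * (1 - v)

/-- The predictive density of the next observation, at a point where the density ratio is `y`. -/
noncomputable def predDensity (θ v y : ℝ) : ℝ := prior θ v * y + (1 - prior θ v) * (1 - y)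

/-- The posterior probability of a change, after an observation where the density ratio is `y`. -/
noncomputable def bayes (θ v y : ℝ) : ℝ := 1 - (1 - prior θ v) * (1 - y) / predDensity θ v y

@[fun_prop]
theorem measurable_predDensity {A : Type*} [MeasurableSpace A] {f g : A → ℝ} (hf : Measurable f)
    (hg : Measurable g) (θ : ℝ) : Measurable fun a => predDensity θ (f a) (g a) := by
  unfold predDensity prior
  fun_prop

@[fun_prop]
theorem measurable_bayes {A : Type*} [MeasurableSpace A] {f g : A → ℝ} (hf : Measurable f)
    (hg : Measurable g) (θ : ℝ) : Measurable fun a => bayes θ (f a) (g a) := by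
  unfold bayes prior
  fun_prop

variable {θ v v' y y' : ℝ}

theorem prior_pos (hθ : θ ∈ Set.Ioo (0 : ℝ) 1) (hv : v ∈ Set.Icc (0 : ℝ) 1) : 0 < prior θ v := by
  obtain ⟨h1, h2⟩ := hθ
  obtain ⟨h3, h4⟩ := hv
  have : prior θ v = θ + v * (1 - θ) := by unfold prior; ring
  nlinarith [mul_nonneg h3 (sub_nonneg.2 h2.le)]

theorem prior_le_one (hθ : θ ∈ Set.Ioo (0 : ℝ) 1) (hv : v ∈ Set.Icc (0 : ℝ) 1) :
    prior θ v ≤ 1 := by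
  obtain ⟨h1, h2⟩ := hθ
  obtain ⟨h3, h4⟩ := hv
  unfold prior
  nlinarith [mul_nonneg (sub_nonneg.2 h4) (sub_nonneg.2 h2.le)]

theorem prior_mono (hθ : θ ∈ Set.Ioo (0 : ℝ) 1) (h : v ≤ v') : prior θ v ≤ prior θ v' := by
  obtain ⟨h1, h2⟩ := hθ
  unfold prior
  nlinarith [mul_nonneg (sub_nonneg.2 h) (sub_nonneg.2 h2.le)]

theorem predDensity_nonneg (hθ : θ ∈ Set.Ioo (0 : ℝ) 1) (hv : v ∈ Set.Icc (0 : ℝ) 1)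
    (hy : y ∈ Set.Icc (0 : ℝ) 1) : 0 ≤ predDensity θ v y :=
  add_nonneg (mul_nonneg (prior_pos hθ hv).le hy.1)
    (mul_nonneg (sub_nonneg.2 (prior_le_one hθ hv)) (sub_nonneg.2 hy.2))

theorem bayes_mul_predDensity (hθ : θ ∈ Set.Ioo (0 : ℝ) 1) (hv : v ∈ Set.Icc (0 : ℝ) 1)
    (hy : y ∈ Set.Icc (0 : ℝ) 1) : bayes θ v y * predDensity θ v y = prior θ v * y := by
  -- The identity survives a vanishing denominator: `predDensity` is a sum of two nonnegative terms,
  -- so both of them vanish.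
  by_cases h : predDensity θ v y = 0
  · have h1 : 0 ≤ prior θ v * y := mul_nonneg (prior_pos hθ hv).le hy.1
    have h2 : 0 ≤ (1 - prior θ v) * (1 - y) :=
      mul_nonneg (sub_nonneg.2 (prior_le_one hθ hv)) (sub_nonneg.2 hy.2)
    rw [h, mul_zero]
    unfold predDensity at h
    linarith
  · unfold bayes
    rw [sub_mul, div_mul_cancel₀ _ h, one_mul, predDensity]
    ring

theorem one_sub_bayes_mul_predDensity (hθ : θ ∈ Set.Ioo (0 : ℝ) 1) (hv : v ∈ Set.Icc (0 : ℝ) 1)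
    (hy : y ∈ Set.Icc (0 : ℝ) 1) :
    (1 - bayes θ v y) * predDensity θ v y = (1 - prior θ v) * (1 - y) := by
  rw [sub_mul, bayes_mul_predDensity hθ hv hy, predDensity]
  ring

theorem bayes_mem (hθ : θ ∈ Set.Ioo (0 : ℝ) 1) (hv : v ∈ Set.Icc (0 : ℝ) 1)
    (hy : y ∈ Set.Icc (0 : ℝ) 1) : bayes θ v y ∈ Set.Icc (0 : ℝ) 1 := by
  have hd := predDensity_nonneg hθ hv hy
  have h2 : 0 ≤ (1 - prior θ v) * (1 - y) :=
    mul_nonneg (sub_nonneg.2 (prior_le_one hθ hv)) (sub_nonneg.2 hy.2)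
  have h1 : 0 ≤ prior θ v * y := mul_nonneg (prior_pos hθ hv).le hy.1
  have h3 : (1 - prior θ v) * (1 - y) / predDensity θ v y ≤ 1 := by
    refine div_le_one_of_le₀ ?_ hd
    rw [predDensity]
    linarith
  have h4 := div_nonneg h2 hd
  unfold bayes
  exact ⟨by linarith, by linarith⟩

/-- Posterior odds are the product of the prior odds and the likelihood ratio, both of which
increase. The density can vanish only when the prior is 1 and `y = 0`; writing `bayes` as one minus
a fraction gives it the value 1 there, which keeps it monotone. -/
theorem bayes_mono (hθ : θ ∈ Set.Ioo (0 : ℝ) 1) (hv : v ∈ Set.Icc (0 : ℝ) 1)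
    (hv' : v' ∈ Set.Icc (0 : ℝ) 1) (hy : y ∈ Set.Icc (0 : ℝ) 1) (hy' : y' ∈ Set.Icc (0 : ℝ) 1)
    (h : v ≤ v') (h' : y ≤ y') : bayes θ v y ≤ bayes θ v' y' := by
  have hp := prior_mono hθ h
  have hp0 := prior_pos hθ hv
  have hp0' := prior_pos hθ hv'
  have hp1' := prior_le_one hθ hv'
  unfold bayes
  refine sub_le_sub_left ?_ 1
  rcases hp1'.eq_or_lt with h1 | h1
  · rw [h1, sub_self, zero_mul, zero_div]
    exact div_nonneg (mul_nonneg (by linarith) (sub_nonneg.2 hy.2)) (predDensity_nonneg hθ hv hy)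
  have key : ∀ u z : ℝ, 0 < prior θ u → prior θ u < 1 → z ∈ Set.Icc (0 : ℝ) 1 →
      0 < predDensity θ u z := by
    intro u z h2 h3 hz
    rw [predDensity]
    rcases hz.1.eq_or_lt with h4 | h4
    · rw [← h4]
      linarith
    · have := mul_pos h2 h4
      have := mul_nonneg (sub_nonneg.2 h3.le) (sub_nonneg.2 hz.2)
      linarith
  rw [div_le_div_iff₀ (key v' y' hp0' h1 hy') (key v y hp0 (hp.trans_lt h1) hy)]
  -- After cross-multiplication the common term cancels; what remains is the product of these two
  -- comparisons of odds.
  have e : (1 - prior θ v') * (prior θ v) ≤ (1 - prior θ v) * prior θ v' := by nlinarith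
  have e' : (1 - y') * y ≤ (1 - y) * y' := by nlinarith
  have := mul_le_mul e e' (mul_nonneg (sub_nonneg.2 hy'.2) hy.1)
    (mul_nonneg (by linarith) hp0'.le)
  unfold predDensity
  nlinarith

/-- `r` is the density of the second of two probability measures with respect to their sum `ν`. -/
structure IsRatio {E : Type*} [MeasurableSpace E] (ν : Measure E) (r : E → ℝ) : Prop where
  measurable : Measurable r
  mem : ∀ x, r x ∈ Set.Icc (0 : ℝ) 1
  lintegral_post : ∫⁻ x, ENNReal.ofReal (r x) ∂ν = 1
  lintegral_pre : ∫⁻ x, ENNReal.ofReal (1 - r x) ∂ν = 1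

variable {E : Type*} [MeasurableSpace E] {ν : Measure E} {r : E → ℝ}

theorem IsRatio.isFiniteMeasure (hr : IsRatio ν r) : IsFiniteMeasure ν := by
  have h : ∫⁻ x, (ENNReal.ofReal (r x) + ENNReal.ofReal (1 - r x)) ∂ν = 1 + 1 := by
    rw [lintegral_add_left hr.measurable.ennreal_ofReal, hr.lintegral_post, hr.lintegral_pre]
  have h1 : ∀ x, ENNReal.ofReal (r x) + ENNReal.ofReal (1 - r x) = 1 := fun x => by
    rw [← ENNReal.ofReal_add (hr.mem x).1 (sub_nonneg.2 (hr.mem x).2)]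
    simp
  simp only [h1, lintegral_one] at h
  exact ⟨by rw [h]; simp⟩

theorem IsRatio.lintegral_predDensity (hr : IsRatio ν r) (hθ : θ ∈ Set.Ioo (0 : ℝ) 1)
    (hv : v ∈ Set.Icc (0 : ℝ) 1) : ∫⁻ x, ENNReal.ofReal (predDensity θ v (r x)) ∂ν = 1 := by
  have h0 := (prior_pos hθ hv).le
  have h1 := sub_nonneg.2 (prior_le_one hθ hv)
  have : ∀ x, ENNReal.ofReal (predDensity θ v (r x)) =
      ENNReal.ofReal (prior θ v) * ENNReal.ofReal (r x) +
        ENNReal.ofReal (1 - prior θ v) * ENNReal.ofReal (1 - r x) := by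
    intro x
    rw [predDensity, ENNReal.ofReal_add (mul_nonneg h0 (hr.mem x).1)
      (mul_nonneg h1 (sub_nonneg.2 (hr.mem x).2)), ENNReal.ofReal_mul h0, ENNReal.ofReal_mul h1]
  have hm := hr.measurable
  simp_rw [this]
  rw [lintegral_add_left (by fun_prop), lintegral_const_mul _ (by fun_prop),
    lintegral_const_mul _ (by fun_prop), hr.lintegral_post, hr.lintegral_pre, mul_one, mul_one,
    ← ENNReal.ofReal_add h0 h1]
  simp

/-- The predictive law of the next posterior probability is stochastically monotone in the present
posterior probability. -/
theorem IsRatio.lintegral_bayes_anti (hr : IsRatio ν r) (hθ : θ ∈ Set.Ioo (0 : ℝ) 1)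
    (hv : v ∈ Set.Icc (0 : ℝ) 1) (hv' : v' ∈ Set.Icc (0 : ℝ) 1) (h : v ≤ v') {g : ℝ → ℝ≥0∞}
    (hg : AntitoneOn g (Set.Icc 0 1)) (hfin : g (bayes θ v (1 / 2)) ≠ ∞) :
    ∫⁻ x, g (bayes θ v' (r x)) * ENNReal.ofReal (predDensity θ v' (r x)) ∂ν ≤
      ∫⁻ x, g (bayes θ v (r x)) * ENNReal.ofReal (predDensity θ v (r x)) ∂ν := by
  have hm := hr.measurable
  -- The two predictive densities cross where `r x = 1 / 2`: raising `v` moves mass from points with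
  -- `g ≥ c` to points with `g ≤ c`. In other words, $\int (g-c)(d_{v'}-d_v)\le 0$ for the
  -- predictive densities $d$, while both densities integrate to 1. In `ℝ≥0∞` the `c`-terms are
  -- added to the opposite sides and cancelled at the end, which needs `c` finite.
  set c := g (bayes θ v (1 / 2)) with hc
  have hd : ∀ u, Measurable fun x => ENNReal.ofReal (predDensity θ u (r x)) := fun u => by
    fun_prop
  have half : (1 / 2 : ℝ) ∈ Set.Icc (0 : ℝ) 1 := by constructor <;> norm_num
  have hp := prior_mono hθ h
  have key : ∀ x, g (bayes θ v' (r x)) * ENNReal.ofReal (predDensity θ v' (r x)) +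
      c * ENNReal.ofReal (predDensity θ v (r x)) ≤
      g (bayes θ v (r x)) * ENNReal.ofReal (predDensity θ v (r x)) +
      c * ENNReal.ofReal (predDensity θ v' (r x)) := by
    intro x
    have h1 : g (bayes θ v' (r x)) ≤ g (bayes θ v (r x)) :=
      hg (bayes_mem hθ hv (hr.mem x)) (bayes_mem hθ hv' (hr.mem x))
        (bayes_mono hθ hv hv' (hr.mem x) (hr.mem x) h le_rfl)
    refine (add_le_add_left (mul_le_mul_left h1 _) _).trans ?_
    have hdiff : predDensity θ v' (r x) - predDensity θ v (r x) =
        (prior θ v' - prior θ v) * (2 * r x - 1) := by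
      unfold predDensity
      ring
    rcases le_total (r x) (1 / 2) with h2 | h2
    · have h3 : c ≤ g (bayes θ v (r x)) := hg (bayes_mem hθ hv (hr.mem x))
        (bayes_mem hθ hv half) (bayes_mono hθ hv hv (hr.mem x) half le_rfl h2)
      have h4 : ENNReal.ofReal (predDensity θ v' (r x)) ≤
          ENNReal.ofReal (predDensity θ v (r x)) := ENNReal.ofReal_le_ofReal (by nlinarith)
      obtain ⟨e, he⟩ := exists_add_of_le h4
      rw [he, mul_add, mul_add, add_assoc, add_comm (c * _) (c * e), ← add_assoc, ← add_assoc]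
      gcongr
    · have h3 : g (bayes θ v (r x)) ≤ c := hg (bayes_mem hθ hv half)
        (bayes_mem hθ hv (hr.mem x)) (bayes_mono hθ hv hv half (hr.mem x) le_rfl h2)
      have h4 : ENNReal.ofReal (predDensity θ v (r x)) ≤
          ENNReal.ofReal (predDensity θ v' (r x)) := ENNReal.ofReal_le_ofReal (by nlinarith)
      obtain ⟨e, he⟩ := exists_add_of_le h4
      rw [he, mul_add, mul_add, add_assoc, add_comm (_ * e) (c * _)]
      gcongr
  have := lintegral_mono (μ := ν) key
  rw [lintegral_add_right _ ((hd v).const_mul c), lintegral_add_right _ ((hd v').const_mul c),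
    lintegral_const_mul _ (hd v), lintegral_const_mul _ (hd v'), hr.lintegral_predDensity hθ hv,
    hr.lintegral_predDensity hθ hv', mul_one] at this
  exact (ENNReal.add_le_add_iff_right hfin).1 this

end Filter

section Pi

variable {ι : Type*} [Fintype ι] {E : Type*} [MeasurableSpace E]

/-- By Tonelli, coordinate `i` can be integrated first; this reduces changing one posterior to a
one-dimensional comparison. -/
theorem lintegral_pi_le_of_update [DecidableEq ι] (ν : Measure E) [IsFiniteMeasure ν]
    {f g : (ι → E) → ℝ≥0∞}
    (hf : Measurable f) (hg : Measurable g) (i : ι)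
    (h : ∀ x, ∫⁻ y, f (Function.update x i y) ∂ν ≤ ∫⁻ y, g (Function.update x i y) ∂ν) :
    ∫⁻ x, f x ∂Measure.pi (fun _ => ν) ≤ ∫⁻ x, g x ∂Measure.pi (fun _ => ν) := by
  rcases isEmpty_or_nonempty E with hE | ⟨⟨e⟩⟩
  · have : IsEmpty (ι → E) := ⟨fun x => hE.elim (x i)⟩
    simp
  rw [lintegral_eq_lmarginal_univ (fun _ => e), lintegral_eq_lmarginal_univ (fun _ => e),
    lmarginal_erase' _ hf (Finset.mem_univ i), lmarginal_erase' _ hg (Finset.mem_univ i)]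
  exact lmarginal_mono h _

theorem lintegral_pi_prod (ν : Measure E) [IsFiniteMeasure ν] {f : ι → E → ℝ≥0∞}
    (hf : ∀ i, Measurable (f i)) :
    ∫⁻ x, ∏ i, f i (x i) ∂Measure.pi (fun _ => ν) = ∏ i, ∫⁻ y, f i y ∂ν := by
  classical
  rcases isEmpty_or_nonempty E with hE | ⟨⟨e⟩⟩
  · rcases isEmpty_or_nonempty ι with hι | ⟨⟨i⟩⟩
    · simp
    · have : IsEmpty (ι → E) := ⟨fun x => hE.elim (x i)⟩
      have h0 : ∏ i, ∫⁻ y, f i y ∂ν = 0 := Finset.prod_eq_zero (Finset.mem_univ i) (by simp)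
      rw [h0]
      simp
  have key : ∀ s : Finset ι, ∀ x, (lmarginal (fun _ => ν) s (fun x => ∏ i ∈ s, f i (x i))) x =
      ∏ i ∈ s, ∫⁻ y, f i y ∂ν := by
    intro s
    induction s using Finset.induction_on with
    | empty => intro x; simp
    | insert i s hi ih =>
      intro x
      have hmeas : ∀ s : Finset ι, Measurable fun x : ι → E => ∏ j ∈ s, f j (x j) := fun s =>
        Finset.measurable_fun_prod _ fun j _ => (hf j).comp (measurable_pi_apply j)
      rw [lmarginal_insert' _ (hmeas _) hi]
      have h1 : (fun x : ι → E => ∫⁻ y, ∏ j ∈ insert i s, f j (Function.update x i y j) ∂ν) =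
          fun x => (∫⁻ y, f i y ∂ν) * ∏ j ∈ s, f j (x j) := by
        funext x
        rw [← lintegral_mul_const _ (hf i)]
        refine lintegral_congr fun y => ?_
        rw [Finset.prod_insert hi, Function.update_self]
        congr 1
        refine Finset.prod_congr rfl fun j hj => ?_
        rw [Function.update_of_ne (ne_of_mem_of_not_mem hj hi)]
      rw [h1, Finset.prod_insert hi, ← ih x]
      simp only [lmarginal]
      exact lintegral_const_mul _ ((hmeas s).comp measurable_updateFinset)
  rw [lintegral_eq_lmarginal_univ (fun _ => e)]
  exact key _ _

end Pi

/-! ### The value function of the one-step update rule -/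

section Value

variable {K : ℕ} {E : Type*} [MeasurableSpace E]

/-- The posterior probabilities after the observations `x`, when they are now `v`. -/
noncomputable def nextPost (r : E → ℝ) (θ : ℝ) (v : Fin K → ℝ) (x : Fin K → E) : Fin K → ℝ :=
  fun k => bayes θ (v k) (r (x k))

/-- The predictive density of the observations `x`, when the posterior probabilities are `v`. -/
noncomputable def obsDensity (r : E → ℝ) (θ : ℝ) (v : Fin K → ℝ) (x : Fin K → E) : ℝ≥0∞ :=
  ∏ k, ENNReal.ofReal (predDensity θ (v k) (r (x k)))

/-- The expected number of active streams `j` steps later, when the streams in `S` are now selected,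
the posterior probabilities are `v`, and every later active set is given by the update rule. -/
noncomputable def value (ν : Measure E) (r : E → ℝ) (θ α : ℝ) :
    ℕ → Finset (Fin K) → (Fin K → ℝ) → ℝ≥0∞
  | 0, S, _ => S.card
  | j + 1, S, v => ∫⁻ x, value ν r θ α j (updateRule α S (nextPost r θ v x)) (nextPost r θ v x) *
      obsDensity r θ v x ∂Measure.pi (fun _ => ν)

variable {ν : Measure E} {r : E → ℝ} {θ α : ℝ}

theorem measurable_nextPost (hr : Measurable r) {A : Type*} [MeasurableSpace A]
    {f : A → Fin K → ℝ} {g : A → Fin K → E} (hf : Measurable f) (hg : Measurable g) :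
    Measurable fun a => nextPost r θ (f a) (g a) := by
  unfold nextPost
  fun_prop

theorem measurable_obsDensity (hr : Measurable r) {A : Type*} [MeasurableSpace A]
    {f : A → Fin K → ℝ} {g : A → Fin K → E} (hf : Measurable f) (hg : Measurable g) :
    Measurable fun a => obsDensity r θ (f a) (g a) := by
  unfold obsDensity
  fun_prop

theorem measurable_comp_updateRule {G : Finset (Fin K) → (Fin K → ℝ) → ℝ≥0∞}
    (hG : ∀ S, Measurable (G S)) (S : Finset (Fin K)) :
    Measurable fun v => G (updateRule α S v) v := by
  classical
  have : (fun v => G (updateRule α S v) v) =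
      fun v => ∑ T, Set.indicator {w | updateRule α S w = T} (G T) v := by
    funext v
    rw [Finset.sum_eq_single (updateRule α S v)]
    · simp
    · intro T _ hT
      exact Set.indicator_of_notMem (fun h => hT h.symm) _
    · simp
  rw [this]
  exact Finset.measurable_fun_sum _ fun T _ => (hG T).indicator (measurableSet_updateRule_eq α S T)

theorem measurable_value [IsFiniteMeasure ν] (hr : Measurable r) (j : ℕ) (S : Finset (Fin K)) :
    Measurable (value ν r θ α j S) := by
  induction j generalizing S with
  | zero => exact measurable_const
  | succ j ih =>
    refine Measurable.lintegral_prod_right' (f := fun a : (Fin K → ℝ) × (Fin K → E) =>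
      value ν r θ α j (updateRule α S (nextPost r θ a.1 a.2)) (nextPost r θ a.1 a.2) *
      obsDensity r θ a.1 a.2) (Measurable.mul ?_ ?_)
    · exact (measurable_comp_updateRule (α := α) ih S).comp
        (measurable_nextPost (θ := θ) hr measurable_fst measurable_snd)
    · exact measurable_obsDensity hr measurable_fst measurable_snd

theorem nextPost_mem (hr : IsRatio ν r) (hθ : θ ∈ Set.Ioo (0 : ℝ) 1) {v : Fin K → ℝ}
    (hv : ∀ k, v k ∈ Set.Icc (0 : ℝ) 1) (x : Fin K → E) (k : Fin K) :
    nextPost r θ v x k ∈ Set.Icc (0 : ℝ) 1 :=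
  bayes_mem hθ (hv k) (hr.mem _)

theorem lintegral_obsDensity (hr : IsRatio ν r) (hθ : θ ∈ Set.Ioo (0 : ℝ) 1) {v : Fin K → ℝ}
    (hv : ∀ k, v k ∈ Set.Icc (0 : ℝ) 1) :
    ∫⁻ x, obsDensity r θ v x ∂Measure.pi (fun _ => ν) = 1 := by
  have := hr.isFiniteMeasure
  unfold obsDensity
  rw [lintegral_pi_prod ν (f := fun k y => ENNReal.ofReal (predDensity θ (v k) (r y)))]
  · exact Finset.prod_eq_one fun k _ => hr.lintegral_predDensity hθ (hv k)
  · have hm := hr.measurable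
    fun_prop

/-- The bound serves to make `value` finite, as the cancellation in `IsRatio.lintegral_bayes_anti`
requires. -/
theorem value_le_card (hr : IsRatio ν r) (hθ : θ ∈ Set.Ioo (0 : ℝ) 1) (j : ℕ)
    (S : Finset (Fin K)) {v : Fin K → ℝ} (hv : ∀ k, v k ∈ Set.Icc (0 : ℝ) 1) :
    value ν r θ α j S v ≤ K := by
  induction j generalizing S v with
  | zero =>
    have := S.card_le_univ
    rw [Fintype.card_fin] at this
    simpa [value] using this
  | succ j ih =>
    calc value ν r θ α (j + 1) S v
        ≤ ∫⁻ x, (K : ℝ≥0∞) * obsDensity r θ v x ∂Measure.pi (fun _ => ν) :=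
          lintegral_mono fun x => mul_le_mul_left (ih _ (nextPost_mem hr hθ hv x)) _
      _ = K := by
          rw [lintegral_const_mul _ (measurable_obsDensity hr.measurable measurable_const
            measurable_id'), lintegral_obsDensity hr hθ hv, mul_one]

/-- The expectation of a function of the next posterior probabilities which is antitone in those with
index in `S`, and does not depend on the others, decreases when one of the present posterior
probabilities increases. -/
theorem lintegral_nextPost_le_update (hr : IsRatio ν r) (hθ : θ ∈ Set.Ioo (0 : ℝ) 1)
    {G : (Fin K → ℝ) → ℝ≥0∞} (hG : Measurable G) {S : Finset (Fin K)}
    (hanti : ∀ z z', (∀ k, z k ∈ Set.Icc (0 : ℝ) 1) → (∀ k, z' k ∈ Set.Icc (0 : ℝ) 1) →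
      (∀ k ∈ S, z k ≤ z' k) → G z' ≤ G z)
    (hfin : ∀ z, (∀ k, z k ∈ Set.Icc (0 : ℝ) 1) → G z ≠ ∞)
    {v : Fin K → ℝ} (hv : ∀ k, v k ∈ Set.Icc (0 : ℝ) 1) {i : Fin K} {u : ℝ}
    (hu : u ∈ Set.Icc (0 : ℝ) 1) (hle : i ∈ S → u ≤ v i) :
    ∫⁻ x, G (nextPost r θ v x) * obsDensity r θ v x ∂Measure.pi (fun _ => ν) ≤
      ∫⁻ x, G (nextPost r θ (Function.update v i u) x) * obsDensity r θ (Function.update v i u) x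
        ∂Measure.pi (fun _ => ν) := by
  have := hr.isFiniteMeasure
  have hmeas : ∀ w : Fin K → ℝ, Measurable fun x : Fin K → E =>
      G (nextPost r θ w x) * obsDensity r θ w x := fun w =>
    (hG.comp (measurable_nextPost hr.measurable measurable_const measurable_id')).mul
      (measurable_obsDensity hr.measurable measurable_const measurable_id')
  refine lintegral_pi_le_of_update ν (hmeas _) (hmeas _) i fun x => ?_
  set z := nextPost r θ v x with hz
  have hzm : ∀ k, z k ∈ Set.Icc (0 : ℝ) 1 := nextPost_mem hr hθ hv x
  set C : ℝ≥0∞ := ∏ k ∈ Finset.univ.erase i, ENNReal.ofReal (predDensity θ (v k) (r (x k))) with hC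
  have hCfin : C ≠ ∞ := ENNReal.prod_ne_top fun k _ => ENNReal.ofReal_ne_top
  have key : ∀ c y, G (nextPost r θ (Function.update v i c) (Function.update x i y)) *
      obsDensity r θ (Function.update v i c) (Function.update x i y) =
      G (Function.update z i (bayes θ c (r y))) * ENNReal.ofReal (predDensity θ c (r y)) * C := by
    intro c y
    have h1 : nextPost r θ (Function.update v i c) (Function.update x i y) =
        Function.update z i (bayes θ c (r y)) := by
      funext k
      rcases eq_or_ne k i with rfl | hk
      · simp [nextPost]
      · simp [nextPost, hz, hk]
    have h2 : obsDensity r θ (Function.update v i c) (Function.update x i y) =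
        ENNReal.ofReal (predDensity θ c (r y)) * C := by
      rw [obsDensity, ← Finset.mul_prod_erase _ _ (Finset.mem_univ i), Function.update_self,
        Function.update_self, hC]
      congr 1
      refine Finset.prod_congr rfl fun k hk => ?_
      rw [Function.update_of_ne (Finset.ne_of_mem_erase hk),
        Function.update_of_ne (Finset.ne_of_mem_erase hk)]
    rw [h1, h2, mul_assoc]
  have hleft := key (v i)
  rw [Function.update_eq_self] at hleft
  simp_rw [key, hleft]
  rw [lintegral_mul_const' _ _ hCfin, lintegral_mul_const' _ _ hCfin]
  refine mul_le_mul_left ?_ _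
  have hupd : ∀ c ∈ Set.Icc (0 : ℝ) 1, ∀ k, Function.update z i c k ∈ Set.Icc (0 : ℝ) 1 := by
    intro c hc k
    rcases eq_or_ne k i with rfl | hk
    · simpa using hc
    · simpa [hk] using hzm k
  by_cases hi : i ∈ S
  · refine hr.lintegral_bayes_anti hθ hu (hv i) (hle hi) (g := fun c => G (Function.update z i c))
      ?_ ?_
    · intro a ha b hb hab
      refine hanti _ _ (hupd a ha) (hupd b hb) fun k _ => ?_
      rcases eq_or_ne k i with rfl | hk
      · simpa using hab
      · simp [hk]
    · exact hfin _ (hupd _ (bayes_mem hθ hu ⟨by norm_num, by norm_num⟩))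
  -- For `i ∉ S`, `hanti` applies in both directions, so `G` ignores coordinate `i`. Only the
  -- predictive density is left to integrate, and its mass is 1 for any posterior; hence `u` need
  -- not be compared with `v i`.
  · have hconst : ∀ c ∈ Set.Icc (0 : ℝ) 1, G (Function.update z i c) = G z := by
      intro c hc
      have h : ∀ k ∈ S, Function.update z i c k = z k := fun k hk =>
        Function.update_of_ne (ne_of_mem_of_not_mem hk hi) _ _
      exact le_antisymm (hanti _ _ hzm (hupd c hc) fun k hk => (h k hk).ge)
        (hanti _ _ (hupd c hc) hzm fun k hk => (h k hk).le)
    have hd : ∀ c, Measurable fun x => ENNReal.ofReal (predDensity θ c (r x)) := fun c => by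
      have hm := hr.measurable
      fun_prop
    simp_rw [fun x => hconst _ (bayes_mem hθ (hv i) (hr.mem x)),
      fun x => hconst _ (bayes_mem hθ hu (hr.mem x))]
    rw [lintegral_const_mul _ (hd _), lintegral_const_mul _ (hd _),
      hr.lintegral_predDensity hθ (hv i), hr.lintegral_predDensity hθ hu]

/-- The vector `v'` is turned into `v` one coordinate at a time. Coordinates outside `S` may move
either way. -/
theorem lintegral_nextPost_anti (hr : IsRatio ν r) (hθ : θ ∈ Set.Ioo (0 : ℝ) 1)
    {G : (Fin K → ℝ) → ℝ≥0∞} (hG : Measurable G) {S : Finset (Fin K)}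
    (hanti : ∀ z z', (∀ k, z k ∈ Set.Icc (0 : ℝ) 1) → (∀ k, z' k ∈ Set.Icc (0 : ℝ) 1) →
      (∀ k ∈ S, z k ≤ z' k) → G z' ≤ G z)
    (hfin : ∀ z, (∀ k, z k ∈ Set.Icc (0 : ℝ) 1) → G z ≠ ∞)
    {v v' : Fin K → ℝ} (hv : ∀ k, v k ∈ Set.Icc (0 : ℝ) 1) (hv' : ∀ k, v' k ∈ Set.Icc (0 : ℝ) 1)
    (hle : ∀ k ∈ S, v k ≤ v' k) :
    ∫⁻ x, G (nextPost r θ v' x) * obsDensity r θ v' x ∂Measure.pi (fun _ => ν) ≤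
      ∫⁻ x, G (nextPost r θ v x) * obsDensity r θ v x ∂Measure.pi (fun _ => ν) := by
  have key : ∀ s : Finset (Fin K),
      ∫⁻ x, G (nextPost r θ v' x) * obsDensity r θ v' x ∂Measure.pi (fun _ => ν) ≤
      ∫⁻ x, G (nextPost r θ (s.piecewise v v') x) * obsDensity r θ (s.piecewise v v') x
        ∂Measure.pi (fun _ => ν) := by
    intro s
    induction s using Finset.induction_on with
    | empty => simp
    | insert i s hi ih =>
      rw [Finset.piecewise_insert]
      refine ih.trans (lintegral_nextPost_le_update hr hθ hG hanti hfin (fun k => ?_) (hv i) ?_)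
      · by_cases hk : k ∈ s
        · simpa [hk] using hv k
        · simpa [hk] using hv' k
      · simpa [hi] using hle i
  simpa using key Finset.univ

/-- The value function is monotone: a state which dominates another has a larger value. -/
theorem value_mono (hr : IsRatio ν r) (hθ : θ ∈ Set.Ioo (0 : ℝ) 1) (hα : 0 ≤ α) (j : ℕ)
    {S' S : Finset (Fin K)} {v' v : Fin K → ℝ} (hv : ∀ k, v k ∈ Set.Icc (0 : ℝ) 1)
    (hv' : ∀ k, v' k ∈ Set.Icc (0 : ℝ) 1) (h : Dominated S' v' S v) :
    value ν r θ α j S' v' ≤ value ν r θ α j S v := by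
  have := hr.isFiniteMeasure
  induction j generalizing S' S v' v with
  | zero => simpa [value] using h.card_le
  | succ j ih =>
    obtain ⟨σ, hσ⟩ := h.exists_perm
    have hmeas : ∀ T : Finset (Fin K),
        Measurable fun z => value ν r θ α j (updateRule α T z) z := fun T =>
      measurable_comp_updateRule (fun T => measurable_value hr.measurable j T) T
    -- First the set `S'` is kept and its posteriors are lowered from `v'` to `v ∘ σ`; the
    -- antitonicity of the integrand is the induction hypothesis for the identity matching.
    have hstep := lintegral_nextPost_anti hr hθ (hmeas S') (S := S')
      (fun z z' hz hz' hle => ih hz hz'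
        (Dominated.updateRule hα ⟨id, Function.injective_id.injOn, fun k hk => ⟨hk, hle k hk⟩⟩))
      (fun z hz => ((value_le_card hr hθ j _ hz).trans_lt (ENNReal.natCast_lt_top K)).ne)
      (v := v ∘ σ) (fun k => hv _) hv' (fun k hk => (hσ k hk).2)
    refine hstep.trans ?_
    -- Then the observations are relabelled by `σ`. This is where the streams having a common law
    -- matters: the product measure is invariant, and the densities only change order.
    have hperm : MeasurePreserving (MeasurableEquiv.piCongrLeft (fun _ : Fin K => E) σ.symm)
        (Measure.pi fun _ => ν) (Measure.pi fun _ => ν) :=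
      measurePreserving_piCongrLeft (fun _ => ν) σ.symm
    refine (hperm.lintegral_map_equiv _).trans_le ?_
    refine lintegral_mono fun x => ?_
    have hx : ∀ k, MeasurableEquiv.piCongrLeft (fun _ : Fin K => E) σ.symm x k = x (σ k) := by
      intro k
      have := Equiv.piCongrLeft_apply_apply (fun _ : Fin K => E) σ.symm x (σ k)
      rw [σ.symm_apply_apply] at this
      exact this
    have h1 : nextPost r θ (v ∘ σ) (MeasurableEquiv.piCongrLeft (fun _ : Fin K => E) σ.symm x) =
        fun k => nextPost r θ v x (σ k) := by
      funext k
      simp only [nextPost, hx, Function.comp]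
    have h2 : obsDensity r θ (v ∘ σ) (MeasurableEquiv.piCongrLeft (fun _ : Fin K => E) σ.symm x) =
        obsDensity r θ v x := by
      simp only [obsDensity, hx, Function.comp]
      exact Equiv.prod_comp σ fun k => ENNReal.ofReal (predDensity θ (v k) (r (x k)))
    rw [h1, h2]
    refine mul_le_mul_left ?_ _
    have hz := nextPost_mem hr hθ hv x
    exact ih hz (fun k => hz _)
      (Dominated.updateRule hα ⟨σ, σ.injective.injOn, fun k hk => ⟨(hσ k hk).1, le_rfl⟩⟩)

end Value

/-! ### The information filtration of a procedure -/

section Information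

variable {Ω E : Type*} [MeasurableSpace E] {K : ℕ} {X : Fin K → ℕ → Ω → E}
  {S S' : ℕ → Ω → Finset (Fin K)}

theorem infoField_congr {t : ℕ} (h : ∀ s, 1 ≤ s → s ≤ t → S s = S' s) :
    infoField X S t = infoField X S' t := by
  induction t with
  | zero => rfl
  | succ t ih =>
    rw [infoField, infoField, ih fun s h1 h2 => h s h1 (h2.trans (Nat.le_succ t)),
      h (t + 1) (Nat.succ_pos t) le_rfl]

theorem measurableSet_obsField_active (S : Ω → Finset (Fin K)) (t : ℕ) (Q : Set (Finset (Fin K))) :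
    MeasurableSet[obsField X S t] {ω | S ω ∈ Q} := by
  have h : MeasurableSpace.comap S ⊤ ≤ obsField X S t := le_sup_left
  exact h _ ⟨Q, trivial, rfl⟩

theorem measurableSet_obsField_obs (S : Ω → Finset (Fin K)) (t : ℕ) (k : Fin K) {B : Set E}
    (hB : MeasurableSet B) : MeasurableSet[obsField X S t] {ω | k ∈ S ω ∧ X k t ω ∈ B} := by
  refine (le_sup_right : _ ≤ obsField X S t) _ ?_
  exact MeasurableSpace.measurableSet_generateFrom ⟨k, B, hB, rfl⟩

theorem measurableSet_infoField_active {t : ℕ} (ht : 1 ≤ t) (Q : Set (Finset (Fin K))) :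
    MeasurableSet[infoField X S t] {ω | S t ω ∈ Q} := by
  obtain ⟨t, rfl⟩ := Nat.exists_eq_add_of_le' ht
  exact (le_sup_right : _ ≤ infoField X S (t + 1)) _ (measurableSet_obsField_active _ _ Q)

theorem IsProcedure.measurableSet_next (hS : IsProcedure X S) (t : ℕ) (Q : Set (Finset (Fin K))) :
    MeasurableSet[infoField X S t] {ω | S (t + 1) ω ∈ Q} := by
  rcases Nat.eq_zero_or_pos t with rfl | ht
  · simp only [zero_add, hS.init]
    exact MeasurableSet.const _
  · have : {ω | S (t + 1) ω ∈ Q} = ⋃ s ∈ Q, {ω | S (t + 1) ω = s} := by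
      ext ω
      simp
    rw [this]
    exact MeasurableSet.biUnion Q.to_countable fun s _ => hS.measurable t ht s

/-- The general family `m` serves twice: constant, to give measurability in the ambient space, and
equal to `fullField`, to compare with the information of all streams. -/
theorem IsProcedure.infoField_le (hS : IsProcedure X S) {m : ℕ → MeasurableSpace Ω}
    (hm : Monotone m) (hX : ∀ k t, 1 ≤ t → Measurable[m t] (X k t)) (t : ℕ) :
    infoField X S t ≤ m t := by
  induction t with
  | zero => exact bot_le
  | succ t ih =>
    have ih' := ih.trans (hm (Nat.le_succ t))
    refine sup_le ih' (sup_le ?_ (MeasurableSpace.generateFrom_le ?_))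
    · rintro _ ⟨Q, -, rfl⟩
      exact ih' _ (hS.measurableSet_next t Q)
    · rintro _ ⟨k, B, hB, rfl⟩
      exact MeasurableSet.inter (ih' _ (hS.measurableSet_next t {s | k ∈ s}))
        (hX k (t + 1) (Nat.succ_pos t) hB)

theorem IsProcedure.infoField_le_ambient [mΩ : MeasurableSpace Ω] (hS : IsProcedure X S)
    (hX : ∀ k t, 1 ≤ t → Measurable (X k t)) (t : ℕ) : infoField X S t ≤ mΩ :=
  hS.infoField_le (m := fun _ => mΩ) monotone_const hX t

/-! ### The local false non-discovery rate -/

variable [mΩ : MeasurableSpace Ω] {P : Measure Ω} {τ : Fin K → Ω → ℕ∞}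

theorem measurableSet_changed (hτ : ∀ k, Measurable (τ k)) (k : Fin K) (t : ℕ) :
    MeasurableSet {ω | τ k ω < (t : ℕ∞)} :=
  hτ k (MeasurableSet.of_discrete (s := {m : ℕ∞ | m < t}))

/-- The local false non-discovery rate is the average of the posterior probabilities of the streams
which are kept. -/
theorem lfnrSucc_ae_eq [IsProbabilityMeasure P] (hτ : ∀ k, Measurable (τ k))
    (hX : ∀ k t, 1 ≤ t → Measurable (X k t))
    (hS : IsProcedure X S) (t : ℕ) :
    lfnrSucc P τ X S t =ᵐ[P] fun ω =>
      (∑ k ∈ S (t + 1) ω, postProb (infoField X S t) P τ t k ω) /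
        max ((S (t + 1) ω).card : ℝ) 1 := by
  classical
  have hFle : infoField X S t ≤ mΩ := hS.infoField_le_ambient hX t
  -- FNP is $\sum_k c_k b_k$ with weights `c k` known at time `t`, so they come out of the
  -- conditional expectation.
  set c : Fin K → Ω → ℝ := fun k ω =>
    if k ∈ S (t + 1) ω then (max ((S (t + 1) ω).card : ℝ) 1)⁻¹ else 0 with hc
  set b : Fin K → Ω → ℝ := fun k => {ω | τ k ω < (t : ℕ∞)}.indicator fun _ => 1 with hb
  have hcm : ∀ k, StronglyMeasurable[infoField X S t] (c k) := by
    intro k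
    have : @Measurable _ _ (infoField X S t) ⊤ (S (t + 1)) := fun Q _ => hS.measurableSet_next t Q
    exact ((measurable_from_top (f := fun s : Finset (Fin K) =>
      if k ∈ s then (max (s.card : ℝ) 1)⁻¹ else 0)).comp this).stronglyMeasurable
  have hb_int : ∀ k, Integrable (b k) P := fun k =>
    (integrable_const 1).indicator (measurableSet_changed hτ k t)
  have hcb_int : ∀ k, Integrable (c k * b k) P := by
    intro k
    refine (hb_int k).bdd_mul (c := 1) ((hcm k).mono hFle).aestronglyMeasurable
      (ae_of_all _ fun ω => ?_)
    simp only [hc]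
    split_ifs
    · rw [Real.norm_of_nonneg (by positivity)]
      exact inv_le_one_of_one_le₀ (le_max_right _ _)
    · simp
  have hfnp : fnpSucc τ S t = ∑ k, c k * b k := by
    funext ω
    rw [fnpSucc, Finset.card_filter, Finset.sum_apply, div_eq_mul_inv]
    push_cast
    rw [Finset.sum_mul, ← Finset.sum_subset (Finset.subset_univ (S (t + 1) ω))]
    · refine Finset.sum_congr rfl fun k hk => ?_
      simp [hc, hb, hk, Set.indicator_apply, mul_comm]
    · intro k _ hk
      simp [hc, hk]
  have h1 : lfnrSucc P τ X S t =ᵐ[P] ∑ k, P[c k * b k | infoField X S t] := by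
    rw [lfnrSucc, hfnp]
    exact condExp_finsetSum (fun k _ => hcb_int k) _
  have h2 : ∀ᵐ ω ∂P, ∀ k, P[c k * b k | infoField X S t] ω = c k ω * P[b k | infoField X S t] ω := by
    rw [ae_all_iff]
    intro k
    exact condExp_mul_of_stronglyMeasurable_left (hcm k) (hcb_int k) (hb_int k)
  filter_upwards [h1, h2] with ω h1 h2
  rw [h1, Finset.sum_apply, div_eq_mul_inv, Finset.sum_mul,
    ← Finset.sum_subset (Finset.subset_univ (S (t + 1) ω))]
  · refine Finset.sum_congr rfl fun k hk => ?_
    rw [h2]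
    simp only [hc, hk, if_true, postProb, mul_comm, hb]
  · intro k _ hk
    rw [h2]
    simp [hc, hk]

/-! ### The switching procedures -/

variable {α : ℝ} {A : ℕ → Ω → Finset (Fin K)} {t₀ : ℕ}

theorem switching_succ_of_lt {t : ℕ} (ht : 1 ≤ t) (h : t₀ < t + 1) :
    switching P τ X α A t₀ (t + 1) =
      nextSet (infoField X (switching P τ X α A t₀) t) P τ α (switching P τ X α A t₀ t) t := by
  rw [← switchState_snd]
  have h1 : t ≠ 0 := by omega
  simp only [switching, switchState, if_neg h1, if_neg (not_le.2 h)]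

theorem switching_of_le (hA : IsProcedure X A) {t : ℕ} (ht : 1 ≤ t) (h : t ≤ t₀) :
    switching P τ X α A t₀ t = A t := by
  obtain ⟨t, rfl⟩ := Nat.exists_eq_add_of_le' ht
  rcases Nat.eq_zero_or_pos t with rfl | ht
  · funext ω
    rw [zero_add, hA.init]
    rfl
  · have h1 : t ≠ 0 := by omega
    simp only [switching, switchState, if_neg h1, if_pos h]

theorem switching_infoField_of_le (hA : IsProcedure X A) {t : ℕ} (h : t ≤ t₀) :
    infoField X (switching P τ X α A t₀) t = infoField X A t :=
  infoField_congr fun _ h1 h2 => switching_of_le hA h1 (h2.trans h)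

theorem measurableSet_nextSet {Ω : Type*} {F : MeasurableSpace Ω} [mΩ : MeasurableSpace Ω]
    {P : Measure Ω} {τ : Fin K → Ω → ℕ∞} {S : Ω → Finset (Fin K)}
    (hS : ∀ s, MeasurableSet[F] {ω | S ω = s}) (t : ℕ) (s : Finset (Fin K)) :
    MeasurableSet[F] {ω | nextSet F P τ α S t ω = s} := by
  have h : {ω | nextSet F P τ α S t ω = s} = ⋃ T, {ω | S ω = T} ∩
      (fun ω k => postProb F P τ t k ω) ⁻¹' {w | updateRule α T w = s} := by
    ext ω
    simp [nextSet]
  have hm : Measurable[F] fun ω k => postProb F P τ t k ω :=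
    @measurable_pi_lambda _ _ _ F _ _ fun k => stronglyMeasurable_condExp.measurable
  rw [h]
  exact MeasurableSet.iUnion fun T => (hS T).inter (hm (measurableSet_updateRule_eq α T s))

theorem isProcedure_switching (hA : IsProcedure X A) (α : ℝ) (t₀ : ℕ) :
    IsProcedure X (switching P τ X α A t₀) where
  init _ := rfl
  antitone t ht ω := by
    rcases lt_or_ge t₀ (t + 1) with h | h
    · rw [switching_succ_of_lt ht h]
      exact updateRule_subset _ _ _
    · rw [switching_of_le hA (Nat.succ_pos t) h, switching_of_le hA ht (by omega)]
      exact hA.antitone t ht ω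
  measurable t ht s := by
    rcases lt_or_ge t₀ (t + 1) with h | h
    · rw [switching_succ_of_lt ht h]
      exact measurableSet_nextSet (fun s => measurableSet_infoField_active ht {s}) t s
    · rw [switching_of_le hA (Nat.succ_pos t) h, switching_infoField_of_le hA (by omega)]
      exact hA.measurable t ht s

theorem switching_mem_procedureClass [IsProbabilityMeasure P] (hτ : ∀ k, Measurable (τ k))
    (hX : ∀ k t, 1 ≤ t → Measurable (X k t)) (hα : 0 ≤ α) (hA : A ∈ procedureClass P τ X α)
    (t₀ : ℕ) : switching P τ X α A t₀ ∈ procedureClass P τ X α := by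
  have hS := isProcedure_switching (P := P) (τ := τ) hA.1 α t₀
  refine ⟨hS, fun t => ?_⟩
  rcases Nat.eq_zero_or_pos t with rfl | ht
  · have h0 : fnpSucc τ (switching P τ X α A t₀) 0 = 0 := by
      funext ω
      simp [fnpSucc]
    refine ae_of_all _ fun ω => ?_
    rw [lfnrSucc, h0, condExp_zero]
    exact hα
  rcases lt_or_ge t₀ (t + 1) with h | h
  · filter_upwards [lfnrSucc_ae_eq (P := P) hτ hX hS t] with ω hω
    rw [hω, switching_succ_of_lt ht h]
    exact updateRule_avg_le hα _ _
  · have h1 : lfnrSucc P τ X (switching P τ X α A t₀) t = lfnrSucc P τ X A t := by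
      rw [lfnrSucc, lfnrSucc, switching_infoField_of_le hA.1 (by omega)]
      congr 1
      funext ω
      rw [fnpSucc, fnpSucc, switching_of_le hA.1 (Nat.succ_pos t) h]
    rw [h1]
    exact hA.2 t

theorem switching_zero_eq_proposed (t : ℕ) :
    switching P τ X α A 0 t = proposed P τ X α t := by
  have h : ∀ t, switchState P τ X α A 0 t = proposedState P τ X α t := by
    intro t
    induction t with
    | zero => rfl
    | succ t ih => simp [switchState, proposedState, ih]
  rw [switching, proposed, h]

/-- Every procedure starts with all streams, so following `A` at time 1 commits to nothing. This
covers the case `s = 0` of the comparison of successive switching times. -/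
theorem switching_one_eq_switching_zero (t : ℕ) :
    switching P τ X α A 1 t = switching P τ X α A 0 t := by
  have h : ∀ t, switchState P τ X α A 1 t = switchState P τ X α A 0 t := by
    intro t
    induction t with
    | zero => rfl
    | succ t ih =>
      rcases Nat.eq_zero_or_pos t with rfl | ht
      · rfl
      · have h1 : ¬ t + 1 ≤ 1 := by omega
        simp only [switchState, ih, if_neg h1, if_neg (Nat.not_succ_le_zero t)]
  rw [switching, switching, h]

end Information

/-! ### The full information -/

section FullInformation

variable {Ω E : Type*} {K : ℕ}

/-- The event that the observations at times `1, …, n` lie in the sets `B k t`. -/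
def obsRect (X : Fin K → ℕ → Ω → E) (n : ℕ) (B : Fin K → ℕ → Set E) : Set Ω :=
  {ω | ∀ k, ∀ t ∈ Finset.Icc 1 n, X k t ω ∈ B k t}

variable {X : Fin K → ℕ → Ω → E}

theorem obsRect_univ (n : ℕ) : obsRect X n (fun _ _ => Set.univ) = Set.univ := by
  simp [obsRect]

theorem obsRect_succ (n : ℕ) (B : Fin K → ℕ → Set E) :
    obsRect X (n + 1) B = obsRect X n B ∩ {ω | ∀ k, X k (n + 1) ω ∈ B k (n + 1)} := by
  ext ω
  simp only [obsRect, Finset.mem_Icc, Set.mem_ofPred_eq, Set.mem_inter_iff]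
  constructor
  · exact fun h => ⟨fun k t ht => h k t ⟨ht.1, by omega⟩, fun k => h k (n + 1) ⟨by omega, le_rfl⟩⟩
  · rintro ⟨h1, h2⟩ k t ⟨ht1, ht2⟩
    rcases ht2.lt_or_eq with h | rfl
    · exact h1 k t ⟨ht1, by omega⟩
    · exact h2 k

theorem obsRect_inter (n : ℕ) (B B' : Fin K → ℕ → Set E) :
    obsRect X n B ∩ obsRect X n B' = obsRect X n (fun k t => B k t ∩ B' k t) := by
  ext ω
  simp only [obsRect, Set.mem_ofPred_eq, Set.mem_inter_iff]
  exact ⟨fun h k t ht => ⟨h.1 k t ht, h.2 k t ht⟩,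
    fun h => ⟨fun k t ht => (h k t ht).1, fun k t ht => (h k t ht).2⟩⟩

theorem obsRect_congr {n : ℕ} {B B' : Fin K → ℕ → Set E}
    (h : ∀ k, ∀ t ∈ Finset.Icc 1 n, B k t = B' k t) : obsRect X n B = obsRect X n B' := by
  ext ω
  simp only [obsRect, Set.mem_ofPred_eq]
  exact forall_congr' fun k => forall₂_congr fun t ht => by rw [h k t ht]

theorem obsRect_inter_next (n : ℕ) (B : Fin K → ℕ → Set E) (C : Fin K → Set E) :
    obsRect X n B ∩ {ω | ∀ k, X k (n + 1) ω ∈ C k} =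
      obsRect X (n + 1) (fun k t => if t = n + 1 then C k else B k t) := by
  rw [obsRect_succ]
  congr 1
  · refine obsRect_congr fun k t ht => ?_
    have : t ≠ n + 1 := by
      have := (Finset.mem_Icc.1 ht).2
      omega
    rw [if_neg this]
  · simp

variable [MeasurableSpace E]

/-- The information given by the observations of all streams at times `1, …, n`. -/
@[reducible] def fullField (X : Fin K → ℕ → Ω → E) (n : ℕ) : MeasurableSpace Ω :=
  MeasurableSpace.generateFrom {A | ∃ B, (∀ k t, MeasurableSet (B k t)) ∧ A = obsRect X n B}

theorem isPiSystem_obsRect (n : ℕ) :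
    IsPiSystem {A | ∃ B, (∀ k t, MeasurableSet (B k t)) ∧ A = obsRect X n B} := by
  rintro _ ⟨B, hB, rfl⟩ _ ⟨B', hB', rfl⟩ _
  exact ⟨_, fun k t => (hB k t).inter (hB' k t), obsRect_inter n B B'⟩

theorem measurable_obs_fullField {n t : ℕ} (k : Fin K) (ht : 1 ≤ t) (htn : t ≤ n) :
    Measurable[fullField X n] (X k t) := by
  classical
  intro C hC
  refine MeasurableSpace.measurableSet_generateFrom
    ⟨fun k' t' => if k' = k ∧ t' = t then C else Set.univ, ?_, ?_⟩
  · intro k' t'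
    dsimp only
    split_ifs
    · exact hC
    · exact MeasurableSet.univ
  · ext ω
    simp only [obsRect, Finset.mem_Icc, Set.mem_preimage, Set.mem_ofPred_eq]
    constructor
    · intro h k' t' _
      split_ifs with h'
      · rw [h'.1, h'.2]
        exact h
      · trivial
    · intro h
      simpa using h k t ⟨ht, htn⟩

theorem fullField_le_of_measurable {m : MeasurableSpace Ω} {n : ℕ}
    (hX : ∀ k t, 1 ≤ t → t ≤ n → Measurable[m] (X k t)) : fullField X n ≤ m := by
  refine MeasurableSpace.generateFrom_le ?_
  rintro _ ⟨B, hB, rfl⟩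
  have : obsRect X n B = ⋂ k, ⋂ t ∈ Finset.Icc 1 n, X k t ⁻¹' B k t := by
    ext ω
    simp only [obsRect, Set.mem_ofPred_eq, Set.mem_iInter, Set.mem_preimage]
  rw [this]
  exact MeasurableSet.iInter fun k => Finset.measurableSet_biInter _ fun t ht =>
    hX k t (Finset.mem_Icc.1 ht).1 (Finset.mem_Icc.1 ht).2 (hB k t)

theorem fullField_mono : Monotone (fullField X) := fun _ _ h =>
  fullField_le_of_measurable fun k _ h1 h2 => measurable_obs_fullField k h1 (h2.trans h)

variable [mΩ : MeasurableSpace Ω]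

/-- Two integrals agree on all events of the full information if they agree on rectangles. -/
theorem setLIntegral_eq_of_obsRect {P : Measure Ω} {n : ℕ}
    (hX : ∀ k t, 1 ≤ t → Measurable (X k t)) {f g : Ω → ℝ≥0∞} (hf : ∫⁻ ω, f ω ∂P ≠ ∞)
    (h : ∀ B, (∀ k t, MeasurableSet (B k t)) →
      ∫⁻ ω in obsRect X n B, f ω ∂P = ∫⁻ ω in obsRect X n B, g ω ∂P)
    {A : Set Ω} (hA : MeasurableSet[fullField X n] A) :
    ∫⁻ ω in A, f ω ∂P = ∫⁻ ω in A, g ω ∂P := by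
  have hle : fullField X n ≤ mΩ := fullField_le_of_measurable fun k t h1 _ => hX k t h1
  -- The two integrals are viewed as measures and compared by the π-λ theorem. Finiteness of one
  -- suffices, because the full rectangle equates the total masses.
  have := isFiniteMeasure_withDensity hf
  have hrect : ∀ B, (∀ k t, MeasurableSet (B k t)) →
      P.withDensity f (obsRect X n B) = P.withDensity g (obsRect X n B) := by
    intro B hB
    have hm : MeasurableSet (obsRect X n B) :=
      hle _ (MeasurableSpace.measurableSet_generateFrom ⟨B, hB, rfl⟩)
    rw [withDensity_apply _ hm, withDensity_apply _ hm]
    exact h B hB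
  have key : P.withDensity f A = P.withDensity g A := by
    refine ext_on_measurableSpace_of_generate_finite mΩ _ ?_ hle rfl (isPiSystem_obsRect n) ?_ hA
    · rintro _ ⟨B, hB, rfl⟩
      exact hrect B hB
    · have := hrect (fun _ _ => Set.univ) fun _ _ => MeasurableSet.univ
      rwa [obsRect_univ] at this
  rwa [withDensity_apply _ (hle _ hA), withDensity_apply _ (hle _ hA)] at key

end FullInformation

/-! ### The homogeneous model -/

section Homogeneous

variable {Ω E : Type*} [mΩ : MeasurableSpace Ω] [MeasurableSpace E] {K : ℕ}

/-- The i.i.d. geometric change-point model, written in terms of the sum `ν` of the pre- and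
post-change laws and of the density `r` of the latter with respect to `ν`. -/
structure IsRatioModel (P : Measure Ω) (ν : Measure E) (r : E → ℝ) (τ : Fin K → Ω → ℕ∞)
    (X : Fin K → ℕ → Ω → E) (θ : ℝ) : Prop where
  theta_mem : θ ∈ Set.Ioo (0 : ℝ) 1
  ratio : IsRatio ν r
  measurable_changePoint : ∀ k, Measurable (τ k)
  measurable_obs : ∀ k t, 1 ≤ t → Measurable (X k t)
  indep : iIndepFun τ P
  geometric : ∀ k (m : ℕ), P {ω | τ k ω = m} = ENNReal.ofReal (θ * (1 - θ) ^ m)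
  joint_law : ∀ (m : Fin K → ℕ∞) (n : ℕ) (B : Fin K → ℕ → Set E),
    (∀ k t, MeasurableSet (B k t)) →
    P ({ω | ∀ k, τ k ω = m k} ∩ obsRect X n B) = P {ω | ∀ k, τ k ω = m k} *
      ∏ k, ∏ t ∈ Finset.Icc 1 n, obsLaw ν (fun x => ENNReal.ofReal (1 - r x))
        (fun x => ENNReal.ofReal (r x)) (m k) t (B k t)

variable {P : Measure Ω} {ν : Measure E} {r : E → ℝ}
  {τ : Fin K → Ω → ℕ∞} {X : Fin K → ℕ → Ω → E} {θ : ℝ}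

/-- The streams `(τ k, X k t)` are independent. -/
theorem IsRatioModel.lintegral_obsRect (h : IsRatioModel P ν r τ X θ) (n : ℕ)
    {B : Fin K → ℕ → Set E} (hB : ∀ k t, MeasurableSet (B k t)) (g : Fin K → ℕ∞ → ℝ≥0∞) :
    ∫⁻ ω in obsRect X n B, ∏ k, g k (τ k ω) ∂P =
      ∏ k, ∫⁻ ω, g k (τ k ω) * ∏ t ∈ Finset.Icc 1 n, obsLaw ν (fun x => ENNReal.ofReal (1 - r x))
        (fun x => ENNReal.ofReal (r x)) (τ k ω) t (B k t) ∂P := by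
  set L : Fin K → ℕ∞ → ℝ≥0∞ := fun k m => ∏ t ∈ Finset.Icc 1 n,
    obsLaw ν (fun x => ENNReal.ofReal (1 - r x)) (fun x => ENNReal.ofReal (r x)) m t (B k t) with hL
  have hτ : Measurable fun ω k => τ k ω := measurable_pi_lambda _ h.measurable_changePoint
  -- The change points take countably many joint values. Summing over them lets `joint_law` factor
  -- each term, and independence of the change points turns the sum of products into a product of
  -- integrals.
  have hmap : ∀ (Q : Measure Ω) (f : (Fin K → ℕ∞) → ℝ≥0∞),
      ∫⁻ ω, f (fun k => τ k ω) ∂Q = ∑' m, f m * Q {ω | ∀ k, τ k ω = m k} := by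
    intro Q f
    rw [← lintegral_map (μ := Q) (measurable_of_countable f) hτ, lintegral_countable']
    refine tsum_congr fun m => ?_
    rw [Measure.map_apply hτ (measurableSet_singleton m)]
    congr 2
    ext ω
    simp [funext_iff]
  have h1 := hmap (P.restrict (obsRect X n B)) fun m => ∏ k, g k (m k)
  have h2 := hmap P fun m => ∏ k, g k (m k) * L k (m k)
  rw [h1]
  have h3 := lintegral_prod_eq_prod_lintegral_of_indepFun (μ := P) Finset.univ
    (fun k ω => g k (τ k ω) * L k (τ k ω))
    (h.indep.comp (fun k m => g k m * L k m) fun k => measurable_of_countable _)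
    (fun k => (measurable_of_countable fun m => g k m * L k m).comp (h.measurable_changePoint k))
  rw [← h3, h2]
  refine tsum_congr fun m => ?_
  have hm : MeasurableSet {ω | ∀ k, τ k ω = m k} := by
    have : {ω | ∀ k, τ k ω = m k} = (fun ω k => τ k ω) ⁻¹' {m} := by
      ext ω
      simp [funext_iff]
    rw [this]
    exact hτ (measurableSet_singleton m)
  rw [Measure.restrict_apply hm, h.joint_law m n B hB, Finset.prod_mul_distrib]
  ring

/-- Atoms are removed one at a time from the total mass 1, so nothing has to be known beforehand
about the mass at `∞`. -/
theorem IsRatioModel.measure_ge [IsProbabilityMeasure P] (h : IsRatioModel P ν r τ X θ) (k : Fin K)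
    (n : ℕ) : P {ω | (n : ℕ∞) ≤ τ k ω} = ENNReal.ofReal ((1 - θ) ^ n) := by
  have hm : ∀ s : Set ℕ∞, MeasurableSet {ω | τ k ω ∈ s} := fun s =>
    h.measurable_changePoint k (MeasurableSet.of_discrete (s := s))
  induction n with
  | zero => simp
  | succ n ih =>
    have hu : {ω | (n : ℕ∞) ≤ τ k ω} =
        {ω | τ k ω = n} ∪ {ω | ((n + 1 : ℕ) : ℕ∞) ≤ τ k ω} := by
      ext ω
      simp only [Set.mem_ofPred_eq, Set.mem_union, Nat.cast_add, Nat.cast_one,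
        ENat.add_one_le_iff (ENat.natCast_ne_top n)]
      rw [le_iff_eq_or_lt, eq_comm]
    have hd : Disjoint {ω | τ k ω = n} {ω | ((n + 1 : ℕ) : ℕ∞) ≤ τ k ω} := by
      rw [Set.disjoint_left]
      intro ω h1 h2
      simp only [Set.mem_ofPred_eq] at h1 h2
      rw [h1, Nat.cast_le] at h2
      omega
    rw [hu, measure_union hd (hm {m | ((n + 1 : ℕ) : ℕ∞) ≤ m}), h.geometric] at ih
    have h0 : 0 ≤ 1 - θ := sub_nonneg.2 h.theta_mem.2.le
    have : ENNReal.ofReal ((1 - θ) ^ n) =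
        ENNReal.ofReal (θ * (1 - θ) ^ n) + ENNReal.ofReal ((1 - θ) ^ (n + 1)) := by
      rw [← ENNReal.ofReal_add (mul_nonneg h.theta_mem.1.le (pow_nonneg h0 n)) (pow_nonneg h0 _)]
      congr 1
      ring
    rw [this] at ih
    exact (ENNReal.add_right_inj ENNReal.ofReal_ne_top).1 ih

/-- One step of the hidden Markov chain `1(τ k < n)` in a single stream. -/
theorem IsRatioModel.lintegral_stream_succ [IsProbabilityMeasure P]
    (h : IsRatioModel P ν r τ X θ) (k : Fin K) (n : ℕ) (B : ℕ → Set E) (c₀ c₁ : ℝ≥0∞) :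
    ∫⁻ ω, (if τ k ω < (n + 1 : ℕ) then c₁ else c₀) * ∏ t ∈ Finset.Icc 1 (n + 1),
        obsLaw ν (fun x => ENNReal.ofReal (1 - r x)) (fun x => ENNReal.ofReal (r x))
          (τ k ω) t (B t) ∂P =
      ∫⁻ ω, (if τ k ω < n then ν.withDensity (fun x => ENNReal.ofReal (r x)) (B (n + 1)) * c₁
          else ENNReal.ofReal θ * (ν.withDensity (fun x => ENNReal.ofReal (r x)) (B (n + 1)) * c₁) +
            ENNReal.ofReal (1 - θ) *
              (ν.withDensity (fun x => ENNReal.ofReal (1 - r x)) (B (n + 1)) * c₀)) *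
        ∏ t ∈ Finset.Icc 1 n, obsLaw ν (fun x => ENNReal.ofReal (1 - r x))
          (fun x => ENNReal.ofReal (r x)) (τ k ω) t (B t) ∂P := by
  set νp := ν.withDensity (fun x => ENNReal.ofReal (1 - r x)) with hνp
  set νq := ν.withDensity (fun x => ENNReal.ofReal (r x)) with hνq
  set L : ℕ → ℕ∞ → ℝ≥0∞ := fun n m => ∏ t ∈ Finset.Icc 1 n,
    obsLaw ν (fun x => ENNReal.ofReal (1 - r x)) (fun x => ENNReal.ofReal (r x)) m t (B t) with hL
  set C : ℝ≥0∞ := ∏ t ∈ Finset.Icc 1 n, νp (B t) with hC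
  have hm : ∀ s : Set ℕ∞, MeasurableSet {ω | τ k ω ∈ s} := fun s =>
    h.measurable_changePoint k (MeasurableSet.of_discrete (s := s))
  have heq : MeasurableSet {ω | τ k ω = n} := hm {(n : ℕ∞)}
  have hge : ∀ j : ℕ, MeasurableSet {ω | (j : ℕ∞) ≤ τ k ω} := fun j => hm {m | (j : ℕ∞) ≤ m}
  have hLs : ∀ m, L (n + 1) m = L n m * (if ((n + 1 : ℕ) : ℕ∞) ≤ m then νp (B (n + 1))
      else νq (B (n + 1))) := by
    intro m
    simp only [hL]
    rw [Finset.prod_Icc_succ_top (Nat.succ_pos n)]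
    congr 1
    simp only [obsLaw, hνp, hνq]
    split_ifs <;> rfl
  -- If the change point is at least `n`, the first `n` observations are all pre-change and their
  -- likelihood no longer depends on it. Both sides then share the part `D` on `τ k < n`. The rest
  -- agrees by the memoryless property $P(\tau=n)=\theta P(\tau\ge n)$; observation `n + 1` is
  -- post-change exactly when `τ k ≤ n`.
  have hLC : ∀ m : ℕ∞, (n : ℕ∞) ≤ m → L n m = C := by
    intro m hnm
    refine Finset.prod_congr rfl fun t ht => ?_
    have : (t : ℕ∞) ≤ m := le_trans (by exact_mod_cast (Finset.mem_Icc.1 ht).2) hnm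
    rw [obsLaw, if_pos this]
  set D : Ω → ℝ≥0∞ := {ω | τ k ω < n}.indicator fun ω => νq (B (n + 1)) * c₁ * L n (τ k ω) with hD
  have hDm : Measurable D := by
    refine Measurable.indicator ?_ (hm {m | m < n})
    exact (measurable_of_countable fun m => νq (B (n + 1)) * c₁ * L n m).comp
      (h.measurable_changePoint k)
  have hleft : ∀ ω, (if τ k ω < (n + 1 : ℕ) then c₁ else c₀) * L (n + 1) (τ k ω) =
      D ω + ({ω | τ k ω = n}.indicator (fun _ => νq (B (n + 1)) * c₁ * C) ω +
        {ω | ((n + 1 : ℕ) : ℕ∞) ≤ τ k ω}.indicator (fun _ => νp (B (n + 1)) * c₀ * C) ω) := by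
    intro ω
    rw [hLs]
    rcases lt_trichotomy (τ k ω) (n : ℕ∞) with h1 | h1 | h1
    · have h2 : τ k ω < (n + 1 : ℕ) := h1.trans (by exact_mod_cast Nat.lt_succ_self n)
      simp only [hD, Set.indicator_apply, Set.mem_ofPred_eq, h1, h2, h1.ne, not_le.2 h2, if_true,
        if_false]
      ring
    · have h2 : ((n : ℕ) : ℕ∞) < (n + 1 : ℕ) := by exact_mod_cast Nat.lt_succ_self n
      simp only [hD, Set.indicator_apply, Set.mem_ofPred_eq, h1, h2, lt_irrefl, not_le.2 h2,
        if_true, if_false, hLC _ le_rfl]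
      ring
    · have h2 : ((n + 1 : ℕ) : ℕ∞) ≤ τ k ω := by
        rw [Nat.cast_add, Nat.cast_one, ENat.add_one_le_iff (ENat.natCast_ne_top n)]
        exact h1
      simp only [hD, Set.indicator_apply, Set.mem_ofPred_eq, h1.not_gt, h1.ne', not_lt.2 h2, h2,
        if_true, if_false, hLC _ h1.le]
      ring
  have hright : ∀ ω, (if τ k ω < n then νq (B (n + 1)) * c₁ else
      ENNReal.ofReal θ * (νq (B (n + 1)) * c₁) + ENNReal.ofReal (1 - θ) * (νp (B (n + 1)) * c₀)) *
      L n (τ k ω) = D ω + {ω | (n : ℕ∞) ≤ τ k ω}.indicator (fun _ =>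
        (ENNReal.ofReal θ * (νq (B (n + 1)) * c₁) +
          ENNReal.ofReal (1 - θ) * (νp (B (n + 1)) * c₀)) * C) ω := by
    intro ω
    rcases lt_or_ge (τ k ω) (n : ℕ∞) with h1 | h1
    · simp only [hD, Set.indicator_apply, Set.mem_ofPred_eq, h1, not_le.2 h1, if_true, if_false,
        add_zero]
    · simp only [hD, Set.indicator_apply, Set.mem_ofPred_eq, h1, not_lt.2 h1, if_true, if_false,
        zero_add, hLC _ h1]
  have h0 : 0 ≤ 1 - θ := sub_nonneg.2 h.theta_mem.2.le
  calc _ = ∫⁻ ω, (D ω + ({ω | τ k ω = n}.indicator (fun _ => νq (B (n + 1)) * c₁ * C) ω +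
        {ω | ((n + 1 : ℕ) : ℕ∞) ≤ τ k ω}.indicator (fun _ => νp (B (n + 1)) * c₀ * C) ω)) ∂P :=
        lintegral_congr hleft
    _ = ∫⁻ ω, (D ω + {ω | (n : ℕ∞) ≤ τ k ω}.indicator (fun _ =>
        (ENNReal.ofReal θ * (νq (B (n + 1)) * c₁) +
          ENNReal.ofReal (1 - θ) * (νp (B (n + 1)) * c₀)) * C) ω) ∂P := by
        rw [lintegral_add_left hDm, lintegral_add_left hDm,
          lintegral_add_left (measurable_const.indicator heq), lintegral_indicator_const heq,
          lintegral_indicator_const (hge _), lintegral_indicator_const (hge _), h.measure_ge,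
          h.measure_ge, h.geometric, pow_succ, ENNReal.ofReal_mul h.theta_mem.1.le,
          ENNReal.ofReal_mul (pow_nonneg h0 n)]
        ring
    _ = _ := (lintegral_congr hright).symm

/-- One step of the hidden Markov chain, given the full information. -/
theorem IsRatioModel.lintegral_succ [IsProbabilityMeasure P] (h : IsRatioModel P ν r τ X θ) (n : ℕ)
    {A : Set Ω} (hA : MeasurableSet[fullField X n] A) {B : Fin K → Set E} (hB : ∀ k, MeasurableSet (B k))
    {c₀ c₁ : Fin K → ℝ≥0∞} (hc₀ : ∀ k, c₀ k ≠ ∞) (hc₁ : ∀ k, c₁ k ≠ ∞) :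
    ∫⁻ ω in A ∩ {ω | ∀ k, X k (n + 1) ω ∈ B k},
        ∏ k, (if τ k ω < (n + 1 : ℕ) then c₁ k else c₀ k) ∂P =
      ∫⁻ ω in A, ∏ k,
        (if τ k ω < n then ν.withDensity (fun x => ENNReal.ofReal (r x)) (B k) * c₁ k
          else ENNReal.ofReal θ * (ν.withDensity (fun x => ENNReal.ofReal (r x)) (B k) * c₁ k) +
            ENNReal.ofReal (1 - θ) *
              (ν.withDensity (fun x => ENNReal.ofReal (1 - r x)) (B k) * c₀ k)) ∂P := by
  have hs : MeasurableSet {ω | ∀ k, X k (n + 1) ω ∈ B k} := by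
    have : {ω | ∀ k, X k (n + 1) ω ∈ B k} = ⋂ k, X k (n + 1) ⁻¹' B k := by
      ext ω
      simp
    rw [this]
    exact MeasurableSet.iInter fun k => h.measurable_obs k _ (Nat.succ_pos n) (hB k)
  have hle : fullField X n ≤ mΩ :=
    fullField_le_of_measurable fun k t h1 _ => h.measurable_obs k t h1
  rw [Set.inter_comm, ← setLIntegral_indicator hs]
  refine setLIntegral_eq_of_obsRect h.measurable_obs ?_ (fun B' hB' => ?_) hA
  · refine ((lintegral_mono (g := fun _ => ∏ k, (c₁ k + c₀ k)) fun ω => ?_).trans_lt ?_).ne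
    · refine (Set.indicator_le_self _ _ _).trans (Finset.prod_le_prod' fun k _ => ?_)
      split_ifs
      · exact le_self_add
      · exact le_add_self
    · rw [lintegral_const, measure_univ, mul_one]
      exact ENNReal.prod_lt_top fun k _ =>
        ENNReal.add_lt_top.2 ⟨(hc₁ k).lt_top, (hc₀ k).lt_top⟩
  · rw [setLIntegral_indicator hs, Set.inter_comm, obsRect_inter_next]
    have hB'' : ∀ k t, MeasurableSet (if t = n + 1 then B k else B' k t) := by
      intro k t
      split_ifs
      · exact hB k
      · exact hB' k t
    have e1 := h.lintegral_obsRect (n + 1) hB''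
      (fun k m => if m < (n + 1 : ℕ) then c₁ k else c₀ k)
    have e2 := h.lintegral_obsRect n hB' (fun k m => if m < n then
      ν.withDensity (fun x => ENNReal.ofReal (r x)) (B k) * c₁ k
          else ENNReal.ofReal θ * (ν.withDensity (fun x => ENNReal.ofReal (r x)) (B k) * c₁ k) +
            ENNReal.ofReal (1 - θ) *
              (ν.withDensity (fun x => ENNReal.ofReal (1 - r x)) (B k) * c₀ k))
    refine e1.trans (Eq.trans ?_ e2.symm)
    refine Finset.prod_congr rfl fun k _ => ?_
    have e3 := h.lintegral_stream_succ k n (fun t => if t = n + 1 then B k else B' k t)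
      (c₀ k) (c₁ k)
    refine e3.trans (lintegral_congr fun ω => ?_)
    rw [if_pos rfl]
    congr 1
    refine Finset.prod_congr rfl fun t ht => ?_
    have : t ≠ n + 1 := by
      have := (Finset.mem_Icc.1 ht).2
      omega
    rw [if_neg this]

end Homogeneous

/-! ### The Bayesian filter given the full information -/

section FullFilter

variable {Ω E : Type*} {K : ℕ}

/-- The posterior probability that the change in stream `k` has occurred before time `n`, given the
observations of this stream at times `1, …, n`. -/
noncomputable def fullPost (r : E → ℝ) (θ : ℝ) (X : Fin K → ℕ → Ω → E) : ℕ → Ω → Fin K → ℝ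
  | 0, _, _ => 0
  | n + 1, ω, k => bayes θ (fullPost r θ X n ω k) (r (X k (n + 1) ω))

variable {r : E → ℝ} {X : Fin K → ℕ → Ω → E} {θ : ℝ}

variable [MeasurableSpace E] {ν : Measure E}

theorem fullPost_mem (hr : IsRatio ν r) (hθ : θ ∈ Set.Ioo (0 : ℝ) 1) (n : ℕ) (ω : Ω) (k : Fin K) :
    fullPost r θ X n ω k ∈ Set.Icc (0 : ℝ) 1 := by
  induction n with
  | zero => simp [fullPost]
  | succ n ih => exact bayes_mem hθ ih (hr.mem _)

theorem measurable_fullPost (hr : Measurable r) (n : ℕ) :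
    Measurable[fullField X n] (fullPost r θ X n) := by
  induction n with
  | zero => exact measurable_const
  | succ n ih =>
    refine @measurable_pi_lambda _ _ _ (fullField X (n + 1)) _ _ fun k => ?_
    have h1 : Measurable[fullField X (n + 1)] fun ω => fullPost r θ X n ω k :=
      (measurable_pi_apply k).comp (ih.mono (fullField_mono (Nat.le_succ n)) le_rfl)
    have h2 : Measurable[fullField X (n + 1)] fun ω => r (X k (n + 1) ω) :=
      hr.comp (measurable_obs_fullField k (Nat.succ_pos n) le_rfl)
    exact @measurable_bayes _ (fullField X (n + 1)) _ _ h1 h2 θ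

theorem ofReal_mix {θ v : ℝ} (hθ : θ ∈ Set.Ioo (0 : ℝ) 1) (hv : v ∈ Set.Icc (0 : ℝ) 1)
    (a b : ℝ≥0∞) :
    ENNReal.ofReal v * a +
        ENNReal.ofReal (1 - v) * (ENNReal.ofReal θ * a + ENNReal.ofReal (1 - θ) * b) =
      ENNReal.ofReal (prior θ v) * a + ENNReal.ofReal (1 - prior θ v) * b := by
  have h1 := sub_nonneg.2 hv.2
  have h2 := sub_nonneg.2 hθ.2.le
  have e1 : ENNReal.ofReal (prior θ v) =
      ENNReal.ofReal v + ENNReal.ofReal (1 - v) * ENNReal.ofReal θ := by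
    rw [← ENNReal.ofReal_mul h1, ← ENNReal.ofReal_add hv.1 (mul_nonneg h1 hθ.1.le), prior]
    congr 1
    ring
  have e2 : ENNReal.ofReal (1 - prior θ v) = ENNReal.ofReal (1 - v) * ENNReal.ofReal (1 - θ) := by
    rw [← ENNReal.ofReal_mul h1, prior]
    congr 1
    ring
  rw [e1, e2]
  ring

/-- Bayes' formula. -/
theorem IsRatio.setLIntegral_bayes {v : ℝ} (hr : IsRatio ν r) (hθ : θ ∈ Set.Ioo (0 : ℝ) 1)
    (hv : v ∈ Set.Icc (0 : ℝ) 1) {B : Set E} (hB : MeasurableSet B) (c₀ c₁ : ℝ≥0∞) :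
    ∫⁻ x in B, (ENNReal.ofReal (bayes θ v (r x)) * c₁ +
        ENNReal.ofReal (1 - bayes θ v (r x)) * c₀) * ENNReal.ofReal (predDensity θ v (r x)) ∂ν =
      ENNReal.ofReal (prior θ v) * (ν.withDensity (fun x => ENNReal.ofReal (r x)) B * c₁) +
        ENNReal.ofReal (1 - prior θ v) *
          (ν.withDensity (fun x => ENNReal.ofReal (1 - r x)) B * c₀) := by
  have hm := hr.measurable
  have key : ∀ x, (ENNReal.ofReal (bayes θ v (r x)) * c₁ +
      ENNReal.ofReal (1 - bayes θ v (r x)) * c₀) * ENNReal.ofReal (predDensity θ v (r x)) =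
      (ENNReal.ofReal (prior θ v) * c₁) * ENNReal.ofReal (r x) +
        (ENNReal.ofReal (1 - prior θ v) * c₀) * ENNReal.ofReal (1 - r x) := by
    intro x
    have hb := bayes_mem hθ hv (hr.mem x)
    have e1 := congrArg ENNReal.ofReal (bayes_mul_predDensity hθ hv (hr.mem x))
    have e2 := congrArg ENNReal.ofReal (one_sub_bayes_mul_predDensity hθ hv (hr.mem x))
    rw [ENNReal.ofReal_mul hb.1, ENNReal.ofReal_mul (prior_pos hθ hv).le] at e1
    rw [ENNReal.ofReal_mul (sub_nonneg.2 hb.2),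
      ENNReal.ofReal_mul (sub_nonneg.2 (prior_le_one hθ hv))] at e2
    calc _ = (ENNReal.ofReal (bayes θ v (r x)) * ENNReal.ofReal (predDensity θ v (r x))) * c₁ +
          (ENNReal.ofReal (1 - bayes θ v (r x)) * ENNReal.ofReal (predDensity θ v (r x))) * c₀ := by
          ring
      _ = _ := by
          rw [e1, e2]
          ring
  simp_rw [key]
  rw [lintegral_add_left (by fun_prop), lintegral_const_mul _ (by fun_prop),
    lintegral_const_mul _ (by fun_prop), withDensity_apply _ hB, withDensity_apply _ hB]
  ring

variable [mΩ : MeasurableSpace Ω] {P : Measure Ω} {τ : Fin K → Ω → ℕ∞}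

/-- Given the full information at time `n`, the events `τ k < n` are independent, with probabilities
`fullPost r θ X n`. -/
def FilterCorrect (P : Measure Ω) (r : E → ℝ) (τ : Fin K → Ω → ℕ∞) (X : Fin K → ℕ → Ω → E)
    (θ : ℝ) (n : ℕ) : Prop :=
  ∀ A, MeasurableSet[fullField X n] A → ∀ c₀ c₁ : Fin K → ℝ≥0∞, (∀ k, c₀ k ≠ ∞) →
    (∀ k, c₁ k ≠ ∞) →
    ∫⁻ ω in A, ∏ k, (if τ k ω < n then c₁ k else c₀ k) ∂P =
      ∫⁻ ω in A, ∏ k, (ENNReal.ofReal (fullPost r θ X n ω k) * c₁ k +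
        ENNReal.ofReal (1 - fullPost r θ X n ω k) * c₀ k) ∂P

/-- One transition of the chain pulls weights on the states at `n + 1` back to weights on the states
at `n`. `FilterCorrect` is stated for arbitrary finite weights so that it applies to these. -/
theorem IsRatioModel.filter_step [IsProbabilityMeasure P] (h : IsRatioModel P ν r τ X θ) {n : ℕ}
    (hn : FilterCorrect P r τ X θ n) {A : Set Ω} (hA : MeasurableSet[fullField X n] A)
    {B : Fin K → Set E} (hB : ∀ k, MeasurableSet (B k)) {c₀ c₁ : Fin K → ℝ≥0∞}
    (hc₀ : ∀ k, c₀ k ≠ ∞) (hc₁ : ∀ k, c₁ k ≠ ∞) :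
    ∫⁻ ω in A ∩ {ω | ∀ k, X k (n + 1) ω ∈ B k},
        ∏ k, (if τ k ω < (n + 1 : ℕ) then c₁ k else c₀ k) ∂P =
      ∫⁻ ω in A, ∏ k, (ENNReal.ofReal (prior θ (fullPost r θ X n ω k)) *
          (ν.withDensity (fun x => ENNReal.ofReal (r x)) (B k) * c₁ k) +
        ENNReal.ofReal (1 - prior θ (fullPost r θ X n ω k)) *
          (ν.withDensity (fun x => ENNReal.ofReal (1 - r x)) (B k) * c₀ k)) ∂P := by
  have f1 : IsFiniteMeasure (ν.withDensity fun x => ENNReal.ofReal (r x)) :=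
    isFiniteMeasure_withDensity (by rw [h.ratio.lintegral_post]; exact ENNReal.one_ne_top)
  have f2 : IsFiniteMeasure (ν.withDensity fun x => ENNReal.ofReal (1 - r x)) :=
    isFiniteMeasure_withDensity (by rw [h.ratio.lintegral_pre]; exact ENNReal.one_ne_top)
  have g1 : ∀ k, ν.withDensity (fun x => ENNReal.ofReal (r x)) (B k) * c₁ k ≠ ∞ := fun k =>
    ENNReal.mul_ne_top (measure_ne_top _ _) (hc₁ k)
  have g2 : ∀ k, ν.withDensity (fun x => ENNReal.ofReal (1 - r x)) (B k) * c₀ k ≠ ∞ := fun k =>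
    ENNReal.mul_ne_top (measure_ne_top _ _) (hc₀ k)
  rw [h.lintegral_succ n hA hB hc₀ hc₁, hn A hA _ _ (fun k => ENNReal.add_ne_top.2
    ⟨ENNReal.mul_ne_top ENNReal.ofReal_ne_top (g1 k),
      ENNReal.mul_ne_top ENNReal.ofReal_ne_top (g2 k)⟩) g1]
  refine lintegral_congr fun ω => Finset.prod_congr rfl fun k _ => ?_
  exact ofReal_mix h.theta_mem (fullPost_mem h.ratio h.theta_mem n ω k) _ _

/-- Given the full information at time `n`, the next observations have the predictive density. -/
theorem IsRatioModel.lintegral_predict [IsProbabilityMeasure P] (h : IsRatioModel P ν r τ X θ)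
    {n : ℕ} (hn : FilterCorrect P r τ X θ n) {A : Set Ω} (hA : MeasurableSet[fullField X n] A)
    {F : (Fin K → ℝ) → (Fin K → E) → ℝ≥0∞} (hF : Measurable fun a : _ × _ => F a.1 a.2) :
    ∫⁻ ω in A, F (fullPost r θ X n ω) (fun k => X k (n + 1) ω) ∂P =
      ∫⁻ ω in A, ∫⁻ x, F (fullPost r θ X n ω) x * obsDensity r θ (fullPost r θ X n ω) x
        ∂Measure.pi (fun _ => ν) ∂P := by
  have := h.ratio.isFiniteMeasure
  have hm := h.ratio.measurable
  have hle : fullField X n ≤ mΩ :=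
    fullField_le_of_measurable fun k t h1 _ => h.measurable_obs k t h1
  set V := fullPost r θ X n with hV
  set Y : Ω → Fin K → E := fun ω k => X k (n + 1) ω with hY
  have hVm' : Measurable[fullField X n] V := measurable_fullPost hm n
  have hVm : Measurable V := hVm'.mono hle le_rfl
  have hYm : Measurable Y :=
    measurable_pi_lambda _ fun k => h.measurable_obs k _ (Nat.succ_pos n)
  have hdm : Measurable fun a : (Fin K → ℝ) × (Fin K → E) => obsDensity r θ a.1 a.2 :=
    measurable_obsDensity hm measurable_fst measurable_snd
  -- The claim says that two laws of (posterior, next observation) on `A` coincide. It suffices to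
  -- check products of a measurable set with a box, where `filter_step` with unit weights gives the
  -- predictive probability of the box.
  set ρ₁ := (P.restrict A).map fun ω => (V ω, Y ω) with hρ₁
  set ρ₂ := (((P.restrict A).map V).prod (Measure.pi fun _ => ν)).withDensity
    (fun a => obsDensity r θ a.1 a.2) with hρ₂
  have hρ₂_lint : ∀ G : (Fin K → ℝ) × (Fin K → E) → ℝ≥0∞, Measurable G → ∫⁻ a, G a ∂ρ₂ =
      ∫⁻ ω in A, ∫⁻ x, G (V ω, x) * obsDensity r θ (V ω) x ∂Measure.pi (fun _ => ν) ∂P := by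
    intro G hG
    rw [hρ₂, lintegral_withDensity_eq_lintegral_mul _ hdm hG, lintegral_prod _
      (hdm.mul hG).aemeasurable, lintegral_map (hdm.mul hG).lintegral_prod_right' hVm]
    simp only [Pi.mul_apply, mul_comm]
  have hrect : ∀ C, MeasurableSet C → ∀ B : Fin K → Set E, (∀ k, MeasurableSet (B k)) →
      ρ₁ (C ×ˢ Set.univ.pi B) = ρ₂ (C ×ˢ Set.univ.pi B) := by
    intro C hC B hB
    have hBm : MeasurableSet (Set.univ.pi B) := MeasurableSet.univ_pi hB
    have hA' : MeasurableSet[fullField X n] (V ⁻¹' C ∩ A) := MeasurableSet.inter (hVm' hC) hA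
    have e1 : ρ₁ (C ×ˢ Set.univ.pi B) =
        P (V ⁻¹' C ∩ A ∩ {ω | ∀ k, X k (n + 1) ω ∈ B k}) := by
      rw [hρ₁, Measure.map_apply (hVm.prodMk hYm) (hC.prod hBm),
        Measure.restrict_apply (hVm.prodMk hYm (hC.prod hBm))]
      congr 1
      ext ω
      simp only [Set.mem_inter_iff, Set.mem_preimage, Set.mem_prod, Set.mem_pi, Set.mem_univ,
        true_imp_iff, Set.mem_ofPred_eq, hY]
      tauto
    have e2 := h.filter_step hn hA' hB (c₀ := fun _ => 1) (c₁ := fun _ => 1)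
      (fun _ => ENNReal.one_ne_top) (fun _ => ENNReal.one_ne_top)
    simp only [ite_self, Finset.prod_const_one, setLIntegral_const, one_mul, mul_one] at e2
    rw [e1, e2, ← lintegral_indicator_one (hC.prod hBm), hρ₂_lint _
      (measurable_one.indicator (hC.prod hBm)), Set.inter_comm, ← Set.inter_comm,
      ← setLIntegral_indicator (hVm hC)]
    refine lintegral_congr fun ω => ?_
    by_cases hω : V ω ∈ C
    · rw [Set.indicator_of_mem (show ω ∈ V ⁻¹' C from hω)]
      have e3 : ∀ x, (C ×ˢ Set.univ.pi B).indicator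
          (1 : (Fin K → ℝ) × (Fin K → E) → ℝ≥0∞) (V ω, x) *
          obsDensity r θ (V ω) x = ∏ k, (B k).indicator
            (fun y => ENNReal.ofReal (predDensity θ (V ω k) (r y))) (x k) := by
        intro x
        by_cases hx : ∀ k, x k ∈ B k
        · rw [Set.indicator_of_mem (by simpa [hω] using hx), Pi.one_apply, one_mul, obsDensity]
          refine Finset.prod_congr rfl fun k _ => ?_
          rw [Set.indicator_of_mem (hx k)]
        · rw [Set.indicator_of_notMem (by simpa [hω] using hx), zero_mul]
          obtain ⟨k, hk⟩ := not_forall.1 hx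
          exact (Finset.prod_eq_zero (Finset.mem_univ k) (Set.indicator_of_notMem hk _)).symm
      simp_rw [e3]
      rw [lintegral_pi_prod ν fun k => Measurable.indicator (by fun_prop) (hB k)]
      refine Finset.prod_congr rfl fun k _ => ?_
      have hb := h.ratio.setLIntegral_bayes h.theta_mem
        (fullPost_mem (X := X) h.ratio h.theta_mem n ω k) (hB k) 1 1
      simp only [mul_one] at hb
      rw [lintegral_indicator (hB k), ← hb]
      refine lintegral_congr fun x => ?_
      have hbm := bayes_mem h.theta_mem (fullPost_mem (X := X) h.ratio h.theta_mem n ω k)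
        (h.ratio.mem x)
      rw [← ENNReal.ofReal_add hbm.1 (sub_nonneg.2 hbm.2), add_sub_cancel, ENNReal.ofReal_one,
        one_mul]
    · rw [Set.indicator_of_notMem (show ω ∉ V ⁻¹' C from hω)]
      have e3 : ∀ x, (C ×ˢ Set.univ.pi B).indicator
          (1 : (Fin K → ℝ) × (Fin K → E) → ℝ≥0∞) (V ω, x) = 0 := fun x =>
        Set.indicator_of_notMem (fun hx => hω (Set.mem_prod.1 hx).1) _
      simp [e3]
  have hρ : ρ₁ = ρ₂ := by
    have : IsFiniteMeasure ρ₁ := by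
      rw [hρ₁]
      infer_instance
    refine ext_of_generate_finite _ (generateFrom_eq_prod (C := {s : Set (Fin K → ℝ) |
      MeasurableSet s}) (D := Set.univ.pi '' Set.univ.pi fun _ : Fin K => {s : Set E |
        MeasurableSet s}) MeasurableSpace.generateFrom_measurableSet generateFrom_pi
        isCountablySpanning_measurableSet
        (IsCountablySpanning.pi fun _ => isCountablySpanning_measurableSet)).symm
      (MeasurableSpace.isPiSystem_measurableSet.prod isPiSystem_pi) ?_ ?_
    · rintro _ ⟨C, hC, _, ⟨B, hB, rfl⟩, rfl⟩
      exact hrect C hC B fun k => hB k (Set.mem_univ k)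
    · have := hrect Set.univ MeasurableSet.univ (fun _ => Set.univ) fun _ => MeasurableSet.univ
      rwa [Set.pi_univ, Set.univ_prod_univ] at this
  rw [← hρ₂_lint _ hF, ← hρ, hρ₁, lintegral_map hF (hVm.prodMk hYm)]

/-- Induction on time, tested on rectangles: `filter_step` evaluates the side with the true states,
`lintegral_predict` integrates out the new observations on the other, and Bayes' formula matches the
two stream by stream. At time 0 no change can precede, which is why `fullPost` starts at 0. -/
theorem IsRatioModel.filterCorrect [IsProbabilityMeasure P] (h : IsRatioModel P ν r τ X θ) (n : ℕ) :
    FilterCorrect P r τ X θ n := by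
  have := h.ratio.isFiniteMeasure
  have hm := h.ratio.measurable
  induction n with
  | zero =>
    intro A hA c₀ c₁ _ _
    simp [fullPost]
  | succ n ih =>
    intro A hA c₀ c₁ hc₀ hc₁
    refine setLIntegral_eq_of_obsRect h.measurable_obs ?_ (fun B hB => ?_) hA
    · refine ((lintegral_mono (g := fun _ => ∏ k, (c₁ k + c₀ k)) fun ω => ?_).trans_lt ?_).ne
      · refine Finset.prod_le_prod' fun k _ => ?_
        split_ifs
        · exact le_self_add
        · exact le_add_self
      · rw [lintegral_const, measure_univ, mul_one]
        exact ENNReal.prod_lt_top fun k _ =>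
          ENNReal.add_lt_top.2 ⟨(hc₁ k).lt_top, (hc₀ k).lt_top⟩
    · have hR : MeasurableSet[fullField X n] (obsRect X n B) :=
        MeasurableSpace.measurableSet_generateFrom ⟨B, hB, rfl⟩
      have hs : MeasurableSet {ω | ∀ k, X k (n + 1) ω ∈ B k (n + 1)} := by
        have : {ω | ∀ k, X k (n + 1) ω ∈ B k (n + 1)} =
            ⋂ k, X k (n + 1) ⁻¹' B k (n + 1) := by
          ext ω
          simp
        rw [this]
        exact MeasurableSet.iInter fun k => h.measurable_obs k _ (Nat.succ_pos n) (hB k _)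
      rw [obsRect_succ, h.filter_step ih hR (fun k => hB k (n + 1)) hc₀ hc₁, Set.inter_comm,
        ← setLIntegral_indicator hs]
      set f : Fin K → (Fin K → ℝ) → E → ℝ≥0∞ := fun k v => (B k (n + 1)).indicator fun x =>
        ENNReal.ofReal (bayes θ (v k) (r x)) * c₁ k +
          ENNReal.ofReal (1 - bayes θ (v k) (r x)) * c₀ k with hf
      have hfm : Measurable fun a : (Fin K → ℝ) × (Fin K → E) => ∏ k, f k a.1 (a.2 k) := by
        refine Finset.measurable_fun_prod _ fun k _ => ?_
        simp only [hf]
        exact Measurable.ite (measurable_snd.eval (a := k) (hB k (n + 1))) (by fun_prop)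
          measurable_const
      have hp := h.lintegral_predict ih hR (F := fun v x => ∏ k, f k v (x k)) hfm
      have e1 : ∀ ω, {ω | ∀ k, X k (n + 1) ω ∈ B k (n + 1)}.indicator (fun ω =>
          ∏ k, (ENNReal.ofReal (fullPost r θ X (n + 1) ω k) * c₁ k +
            ENNReal.ofReal (1 - fullPost r θ X (n + 1) ω k) * c₀ k)) ω =
          ∏ k, f k (fullPost r θ X n ω) (X k (n + 1) ω) := by
        intro ω
        by_cases hω : ∀ k, X k (n + 1) ω ∈ B k (n + 1)
        · rw [Set.indicator_of_mem (by exact hω)]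
          refine Finset.prod_congr rfl fun k _ => ?_
          simp only [hf]
          rw [Set.indicator_of_mem (hω k)]
          rfl
        · rw [Set.indicator_of_notMem (by exact hω)]
          obtain ⟨k, hk⟩ := not_forall.1 hω
          exact (Finset.prod_eq_zero (Finset.mem_univ k) (Set.indicator_of_notMem hk _)).symm
      simp_rw [e1]
      rw [hp]
      refine lintegral_congr fun ω => ?_
      simp only [obsDensity, ← Finset.prod_mul_distrib]
      rw [lintegral_pi_prod ν (f := fun k x => f k (fullPost r θ X n ω) x *
        ENNReal.ofReal (predDensity θ (fullPost r θ X n ω k) (r x))) fun k =>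
          (Measurable.indicator (by fun_prop) (hB k _)).mul (by fun_prop)]
      refine Finset.prod_congr rfl fun k _ => ?_
      rw [← h.ratio.setLIntegral_bayes h.theta_mem (fullPost_mem h.ratio h.theta_mem n ω k)
        (hB k (n + 1)), ← lintegral_indicator (hB k (n + 1))]
      refine lintegral_congr fun x => ?_
      by_cases hx : x ∈ B k (n + 1) <;> simp [hf, hx]

end FullFilter

/-! ### The posterior probabilities of the active streams -/

section Posterior

variable {Ω E : Type*} [MeasurableSpace E] {K : ℕ} {X : Fin K → ℕ → Ω → E} {r : E → ℝ} {θ : ℝ}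

/-- The observations of an active stream determine its posterior probability. -/
theorem IsProcedure.measurable_fullPost_active {S : ℕ → Ω → Finset (Fin K)}
    (hS : IsProcedure X S) (hr : Measurable r) (k : Fin K) (t : ℕ) :
    Measurable[infoField X S t] fun ω => if k ∈ S t ω then fullPost r θ X t ω k else 0 := by
  induction t with
  | zero =>
    simp only [fullPost, ite_self]
    exact measurable_const
  | succ t ih =>
    have ih' : Measurable[infoField X S (t + 1)]
        fun ω => if k ∈ S t ω then fullPost r θ X t ω k else 0 := ih.mono le_sup_left le_rfl
    have hk : MeasurableSet[infoField X S (t + 1)] {ω | k ∈ S (t + 1) ω} :=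
      measurableSet_infoField_active (Nat.succ_pos t) {s | k ∈ s}
    have hr' : Measurable[infoField X S (t + 1)]
        fun ω => if k ∈ S (t + 1) ω then r (X k (t + 1) ω) else 0 := by
      intro C hC
      have e : (fun ω => if k ∈ S (t + 1) ω then r (X k (t + 1) ω) else 0) ⁻¹' C =
          {ω | k ∈ S (t + 1) ω ∧ X k (t + 1) ω ∈ r ⁻¹' C} ∪
            ({ω | k ∈ S (t + 1) ω}ᶜ ∩ {_ω | (0 : ℝ) ∈ C}) := by
        ext ω
        by_cases h : k ∈ S (t + 1) ω <;> simp [h]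
      rw [e]
      have h1 : MeasurableSet[infoField X S (t + 1)]
          {ω | k ∈ S (t + 1) ω ∧ X k (t + 1) ω ∈ r ⁻¹' C} :=
        (le_sup_right : _ ≤ infoField X S (t + 1)) _ (measurableSet_obsField_obs _ _ k (hr hC))
      exact h1.union (hk.compl.inter (MeasurableSet.const _))
    have e : (fun ω => if k ∈ S (t + 1) ω then fullPost r θ X (t + 1) ω k else 0) =
        fun ω => if k ∈ S (t + 1) ω then
          bayes θ (if k ∈ S t ω then fullPost r θ X t ω k else 0)
            (if k ∈ S (t + 1) ω then r (X k (t + 1) ω) else 0) else 0 := by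
      funext ω
      by_cases h : k ∈ S (t + 1) ω
      -- A stream active now was active before, so its previous posterior was available. At `t = 0`
      -- the unused set `S 0` is arbitrary, but both branches are 0.
      · have h' : (if k ∈ S t ω then fullPost r θ X t ω k else 0) = fullPost r θ X t ω k := by
          rcases Nat.eq_zero_or_pos t with rfl | ht
          · simp [fullPost]
          · rw [if_pos (hS.antitone t ht ω h)]
        rw [if_pos h, if_pos h, if_pos h, h']
        rfl
      · rw [if_neg h, if_neg h]
    rw [e]
    exact Measurable.ite hk (@measurable_bayes _ (infoField X S (t + 1)) _ _ ih' hr' θ)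
      measurable_const

variable [mΩ : MeasurableSpace Ω] {P : Measure Ω} {ν : Measure E} {τ : Fin K → Ω → ℕ∞}

theorem IsRatioModel.fullField_le (h : IsRatioModel P ν r τ X θ) (n : ℕ) : fullField X n ≤ mΩ :=
  fullField_le_of_measurable fun k t h1 _ => h.measurable_obs k t h1

theorem IsRatioModel.measurable_fullPost (h : IsRatioModel P ν r τ X θ) (n : ℕ) :
    Measurable (fullPost r θ X n) :=
  (CompoundDetection.measurable_fullPost h.ratio.measurable n).mono (h.fullField_le n) le_rfl

variable [IsProbabilityMeasure P]

theorem IsRatioModel.fullPost_ae_eq_condExp (h : IsRatioModel P ν r τ X θ) (n : ℕ) (k : Fin K) :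
    (fun ω => fullPost r θ X n ω k) =ᵐ[P] P⟦{ω | τ k ω < (n : ℕ∞)} | fullField X n⟧ := by
  have hle := h.fullField_le n
  have hs := measurableSet_changed h.measurable_changePoint k n
  have hV : Measurable fun ω => fullPost r θ X n ω k :=
    (measurable_pi_apply k).comp (h.measurable_fullPost n)
  have hmem := fun ω => fullPost_mem (X := X) h.ratio h.theta_mem n ω k
  refine ae_eq_condExp_of_forall_setIntegral_eq hle ((integrable_const 1).indicator hs)
    (fun s _ _ => ?_) (fun s hms _ => ?_) ?_
  · refine Integrable.integrableOn (Integrable.of_bound hV.aestronglyMeasurable 1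
      (ae_of_all _ fun ω => ?_))
    rw [Real.norm_of_nonneg (hmem ω).1]
    exact (hmem ω).2
  · rw [integral_eq_lintegral_of_nonneg_ae (ae_of_all _ fun ω => (hmem ω).1)
      hV.aestronglyMeasurable, integral_eq_lintegral_of_nonneg_ae
      (ae_of_all _ fun ω => Set.indicator_nonneg (fun _ _ => zero_le_one) ω)
      (measurable_const.indicator hs).aestronglyMeasurable]
    -- These weights make every factor other than `k` equal to 1 and leave the indicator of `τ k <
    -- n`.
    have hf := h.filterCorrect n s hms (fun i => if i = k then 0 else 1) (fun _ => 1)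
      (fun i => by split_ifs <;> simp) (fun _ => ENNReal.one_ne_top)
    congr 1
    refine Eq.trans (lintegral_congr fun ω => ?_) (hf.symm.trans (lintegral_congr fun ω => ?_))
    · rw [Finset.prod_eq_single k]
      · simp
      · intro i _ hi
        have hb := fullPost_mem (X := X) h.ratio h.theta_mem n ω i
        rw [if_neg hi, mul_one, mul_one, ← ENNReal.ofReal_add hb.1 (sub_nonneg.2 hb.2)]
        simp
      · simp
    · rw [Finset.prod_eq_single k]
      · by_cases hω : τ k ω < n <;> simp [hω]
      · intro i _ hi
        simp [hi]
      · simp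
  · exact ((measurable_pi_apply k).comp
      (CompoundDetection.measurable_fullPost h.ratio.measurable n)).stronglyMeasurable
      |>.aestronglyMeasurable

/-- The posterior probability of an active stream given the information of a procedure is its
posterior probability given the full information. -/
theorem IsRatioModel.postProb_ae_eq (h : IsRatioModel P ν r τ X θ) {S : ℕ → Ω → Finset (Fin K)}
    (hS : IsProcedure X S) {t : ℕ} (ht : 1 ≤ t) :
    ∀ᵐ ω ∂P, ∀ k ∈ S t ω, postProb (infoField X S t) P τ t k ω = fullPost r θ X t ω k := by
  rw [ae_all_iff]
  intro k
  have hle : infoField X S t ≤ fullField X t := hS.infoField_le fullField_mono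
    (fun k t ht => measurable_obs_fullField k ht le_rfl) t
  have hk : MeasurableSet[infoField X S t] {ω | k ∈ S t ω} :=
    measurableSet_infoField_active ht {s | k ∈ s}
  have hmem := fun ω => fullPost_mem (X := X) h.ratio h.theta_mem t ω k
  have hV : Measurable fun ω => fullPost r θ X t ω k :=
    (measurable_pi_apply k).comp (h.measurable_fullPost t)
  have hVint : Integrable (fun ω => fullPost r θ X t ω k) P := by
    refine Integrable.of_bound hV.aestronglyMeasurable 1 (ae_of_all _ fun ω => ?_)
    rw [Real.norm_of_nonneg (hmem ω).1]
    exact (hmem ω).2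
  -- Tower property through the full information. On the event that `k` is active, the full
  -- posterior is already known to the procedure, so the outer conditioning does nothing there.
  have h1 : postProb (infoField X S t) P τ t k =ᵐ[P]
      P[fun ω => fullPost r θ X t ω k | infoField X S t] :=
    (condExp_condExp_of_le hle (h.fullField_le t)).symm.trans
      (condExp_congr_ae (h.fullPost_ae_eq_condExp t k).symm)
  have h2 := condExp_indicator hVint hk
  have e : {ω | k ∈ S t ω}.indicator (fun ω => fullPost r θ X t ω k) =
      fun ω => if k ∈ S t ω then fullPost r θ X t ω k else 0 := by
    funext ω
    by_cases hω : k ∈ S t ω <;> simp [hω]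
  have h3 : P[{ω | k ∈ S t ω}.indicator (fun ω => fullPost r θ X t ω k) | infoField X S t] =
      {ω | k ∈ S t ω}.indicator (fun ω => fullPost r θ X t ω k) := by
    refine condExp_of_stronglyMeasurable (hle.trans (h.fullField_le t)) ?_
      (hVint.indicator ((hle.trans (h.fullField_le t)) _ hk))
    rw [e]
    exact (hS.measurable_fullPost_active h.ratio.measurable k t).stronglyMeasurable
  rw [h3] at h2
  filter_upwards [h1, h2] with ω h1 h2 hω
  rw [Set.indicator_of_mem (by exact hω), Set.indicator_of_mem (by exact hω)] at h2
  rw [h1, h2]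

end Posterior

/-! ### The expected number of active streams -/

section Expectation

variable {K : ℕ}

/-- The rule only looks at active streams, so the agreement of the two posteriors there is enough.
-/
theorem updateRule_congr (α : ℝ) {S : Finset (Fin K)} {w w' : Fin K → ℝ}
    (h : ∀ k ∈ S, w k = w' k) : updateRule α S w = updateRule α S w' := by
  have h1 : ∀ n, firstElems S w n = firstElems S w' n := by
    intro n
    unfold firstElems
    refine Finset.filter_congr fun k hk => ?_
    rw [Finset.filter_congr fun j hj => by rw [h j hj, h k hk]]
  have h2 : ∀ n, ∑ k ∈ firstElems S w' n, w k = ∑ k ∈ firstElems S w' n, w' k := fun n =>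
    Finset.sum_congr rfl fun k hk => h k (firstElems_subset _ _ _ hk)
  unfold updateRule
  simp only [h1, h2]

/-- Splitting over the finitely many active sets freezes the random set, after which
`lintegral_predict` applies to a deterministic function. -/
theorem lintegral_eq_sum_setLIntegral {Ω : Type*} [MeasurableSpace Ω] {P : Measure Ω}
    {S : Ω → Finset (Fin K)} (hS : ∀ s, MeasurableSet {ω | S ω = s})
    {f : Finset (Fin K) → Ω → ℝ≥0∞} (hf : ∀ s, Measurable (f s)) :
    ∫⁻ ω, f (S ω) ω ∂P = ∑ s, ∫⁻ ω in {ω | S ω = s}, f s ω ∂P := by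
  classical
  have e : ∀ ω, f (S ω) ω = ∑ s, {ω | S ω = s}.indicator (f s) ω := by
    intro ω
    rw [Finset.sum_eq_single (S ω)]
    · simp
    · intro s _ hs
      exact Set.indicator_of_notMem (fun h => hs h.symm) _
    · simp
  simp_rw [e]
  rw [lintegral_finsetSum _ fun s _ => (hf s).indicator (hS s)]
  exact Finset.sum_congr rfl fun s _ => lintegral_indicator (hS s) _

variable {Ω E : Type*} [MeasurableSpace E] {X : Fin K → ℕ → Ω → E} {r : E → ℝ} {θ : ℝ}
  [mΩ : MeasurableSpace Ω] {P : Measure Ω} [IsProbabilityMeasure P] {ν : Measure E}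
  {τ : Fin K → Ω → ℕ∞} {α : ℝ}

theorem IsRatioModel.nextSet_ae_eq (h : IsRatioModel P ν r τ X θ) {S : ℕ → Ω → Finset (Fin K)}
    (hS : IsProcedure X S) {t : ℕ} (ht : 1 ≤ t) :
    ∀ᵐ ω ∂P, nextSet (infoField X S t) P τ α (S t) t ω =
      updateRule α (S t ω) (fullPost r θ X t ω) := by
  filter_upwards [h.postProb_ae_eq hS ht] with ω hω
  exact updateRule_congr α hω

/-- The expected number of active streams of a procedure which follows the update rule from time
`n + 2` onwards. -/
theorem IsRatioModel.lintegral_card (h : IsRatioModel P ν r τ X θ) {S : ℕ → Ω → Finset (Fin K)}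
    (hS : IsProcedure X S) (j n : ℕ)
    (hgreedy : ∀ t, n + 1 ≤ t → S (t + 1) = nextSet (infoField X S t) P τ α (S t) t) :
    ∫⁻ ω, ((S (n + 1 + j) ω).card : ℝ≥0∞) ∂P =
      ∫⁻ ω, value ν r θ α j (S (n + 1) ω) (fullPost r θ X n ω) ∂P := by
  have := h.ratio.isFiniteMeasure
  have hr := h.ratio.measurable
  induction j generalizing n with
  | zero => rfl
  | succ j ih =>
    have hle : infoField X S n ≤ fullField X n := hS.infoField_le fullField_mono
      (fun k t ht => measurable_obs_fullField k ht le_rfl) n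
    have hSn : ∀ s, MeasurableSet[fullField X n] {ω | S (n + 1) ω = s} := fun s =>
      hle _ (hS.measurableSet_next n {s})
    have hSn' : ∀ s, MeasurableSet {ω | S (n + 1) ω = s} := fun s => h.fullField_le n _ (hSn s)
    rw [show n + 1 + (j + 1) = (n + 1) + 1 + j by ring,
      ih (n + 1) fun t ht => hgreedy t (by omega),
      lintegral_eq_sum_setLIntegral hSn' (f := fun s ω => value ν r θ α (j + 1) s
        (fullPost r θ X n ω)) fun s => (measurable_value hr _ s).comp (h.measurable_fullPost n)]
    have e1 : ∀ᵐ ω ∂P, value ν r θ α j (S (n + 1 + 1) ω) (fullPost r θ X (n + 1) ω) =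
        value ν r θ α j (updateRule α (S (n + 1) ω) (fullPost r θ X (n + 1) ω))
          (fullPost r θ X (n + 1) ω) := by
      rw [hgreedy (n + 1) le_rfl]
      filter_upwards [h.nextSet_ae_eq (α := α) hS (Nat.succ_pos n)] with ω hω
      rw [hω]
    have hcomp := fun s : Finset (Fin K) => measurable_comp_updateRule (α := α)
      (fun T => measurable_value (ν := ν) (θ := θ) (α := α) hr j T) s
    rw [lintegral_congr_ae e1, lintegral_eq_sum_setLIntegral hSn' (f := fun s ω =>
      value ν r θ α j (updateRule α s (fullPost r θ X (n + 1) ω)) (fullPost r θ X (n + 1) ω))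
      fun s => (hcomp s).comp (h.measurable_fullPost (n + 1))]
    refine Finset.sum_congr rfl fun s _ => ?_
    -- The event $S_{n+1}=s$ is known at time `n`, so the one-step Markov property holds on it and
    -- reproduces the recursion defining `value`.
    exact h.lintegral_predict (h.filterCorrect n) (hSn s)
      (F := fun v x => value ν r θ α j (updateRule α s (nextPost r θ v x)) (nextPost r θ v x))
      ((hcomp s).comp (measurable_nextPost hr measurable_fst measurable_snd))

/-- Both procedures are greedy after time `s + 1`, so both sides are expectations of `value` at the
same posterior vector. Only the selected sets differ, and the update rule's set dominates that of
`A`, whose average is at most $\alpha$ almost surely. -/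
theorem IsRatioModel.lintegral_card_switching_succ_le (h : IsRatioModel P ν r τ X θ) (hα : 0 ≤ α)
    {A : ℕ → Ω → Finset (Fin K)} (hA : A ∈ procedureClass P τ X α) {t : ℕ} (ht : 1 ≤ t) (s : ℕ) :
    ∫⁻ ω, ((switching P τ X α A (s + 1) t ω).card : ℝ≥0∞) ∂P ≤
      ∫⁻ ω, ((switching P τ X α A s t ω).card : ℝ≥0∞) ∂P := by
  rcases Nat.eq_zero_or_pos s with rfl | hs
  · rw [zero_add, switching_one_eq_switching_zero]
  rcases le_or_gt t s with hts | hts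
  · rw [switching_of_le hA.1 ht hts, switching_of_le hA.1 ht (by omega)]
  obtain ⟨j, rfl⟩ := Nat.exists_eq_add_of_le (show s + 1 ≤ t from hts)
  rw [h.lintegral_card (α := α) (isProcedure_switching hA.1 α (s + 1)) j s
      fun t ht => switching_succ_of_lt (by omega) (by omega),
    h.lintegral_card (α := α) (isProcedure_switching hA.1 α s) j s
      fun t ht => switching_succ_of_lt (by omega) (by omega),
    switching_of_le hA.1 (Nat.succ_pos s) le_rfl, switching_succ_of_lt hs (Nat.lt_succ_self s),
    switching_infoField_of_le hA.1 le_rfl, switching_of_le hA.1 hs le_rfl]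
  refine lintegral_mono_ae ?_
  filter_upwards [h.postProb_ae_eq hA.1 hs, hA.2 s,
    lfnrSucc_ae_eq (P := P) h.measurable_changePoint h.measurable_obs hA.1 s] with ω h1 h2 h3
  have hmem := fullPost_mem (X := X) h.ratio h.theta_mem s ω
  have hsub := hA.1.antitone s hs ω
  rw [h3, Finset.sum_congr rfl fun k hk => h1 k (hsub hk)] at h2
  have h4 : nextSet (infoField X A s) P τ α (A s) s ω =
      updateRule α (A s ω) (fullPost r θ X s ω) := updateRule_congr α h1
  rw [h4]
  exact value_mono h.ratio h.theta_mem hα j hmem hmem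
    (dominated_updateRule hα ((Dominated.refl _ _).mono_left hsub) h2)

theorem integral_utilization_mono {S S' : ℕ → Ω → Finset (Fin K)}
    (hX : ∀ k t, 1 ≤ t → Measurable (X k t)) (hS : IsProcedure X S) (hS' : IsProcedure X S')
    (h : ∀ t, 1 ≤ t →
      ∫⁻ ω, ((S t ω).card : ℝ≥0∞) ∂P ≤ ∫⁻ ω, ((S' t ω).card : ℝ≥0∞) ∂P) (t : ℕ) :
    ∫ ω, utilization S t ω ∂P ≤ ∫ ω, utilization S' t ω ∂P := by
  have hm : ∀ {S : ℕ → Ω → Finset (Fin K)}, IsProcedure X S → ∀ s, 1 ≤ s →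
      Measurable fun ω => ((S s ω).card : ℝ) := by
    intro S hS s hs
    have h1 : @Measurable _ _ mΩ ⊤ (S s) := fun Q _ =>
      hS.infoField_le_ambient hX s _ (measurableSet_infoField_active hs Q)
    exact (measurable_from_top (f := fun s : Finset (Fin K) => (s.card : ℝ))).comp h1
  have hb : ∀ s : Finset (Fin K), s.card ≤ K := fun s => by
    simpa using s.card_le_univ
  have hint : ∀ {S : ℕ → Ω → Finset (Fin K)}, IsProcedure X S → ∀ s, 1 ≤ s →
      Integrable (fun ω => ((S s ω).card : ℝ)) P := by
    intro S hS s hs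
    refine Integrable.of_bound (hm hS s hs).aestronglyMeasurable K (ae_of_all _ fun ω => ?_)
    rw [Real.norm_of_nonneg (Nat.cast_nonneg _)]
    exact_mod_cast hb _
  have hI : ∀ {S : ℕ → Ω → Finset (Fin K)}, IsProcedure X S → ∀ s, 1 ≤ s →
      ∫ ω, ((S s ω).card : ℝ) ∂P = (∫⁻ ω, ((S s ω).card : ℝ≥0∞) ∂P).toReal := by
    intro S hS s hs
    rw [integral_eq_lintegral_of_nonneg_ae (ae_of_all _ fun ω => Nat.cast_nonneg _)
      (hm hS s hs).aestronglyMeasurable]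
    simp only [ENNReal.ofReal_natCast]
  simp only [utilization]
  rw [integral_finsetSum _ fun s hs => hint hS s (Finset.mem_Icc.1 hs).1,
    integral_finsetSum _ fun s hs => hint hS' s (Finset.mem_Icc.1 hs).1]
  refine Finset.sum_le_sum fun s hs => ?_
  have hs1 := (Finset.mem_Icc.1 hs).1
  rw [hI hS s hs1, hI hS' s hs1]
  refine ENNReal.toReal_mono ?_ (h s hs1)
  refine ((lintegral_mono (g := fun _ => (K : ℝ≥0∞)) fun ω => ?_).trans_lt ?_).ne
  · exact Nat.cast_le.2 (hb _)
  · rw [lintegral_const, measure_univ, mul_one]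
    exact ENNReal.natCast_lt_top K

end Expectation

/-! ### From densities to the density ratio -/

section Ratio

variable {E : Type*} [MeasurableSpace E]

/-- Take $\nu=(p+q)\mu$ and $r=q/(p+q)$. The ratio stays in $[0,1]$ where $q/p$ could be infinite,
and $\nu$ is finite without any assumption on $\mu$. -/
theorem exists_isRatio {μ : Measure E} {p q : E → ℝ≥0∞} (hp : IsDensity μ p)
    (hq : IsDensity μ q) : ∃ (ν : Measure E) (r : E → ℝ), IsRatio ν r ∧
      ν.withDensity (fun x => ENNReal.ofReal (1 - r x)) = μ.withDensity p ∧
      ν.withDensity (fun x => ENNReal.ofReal (r x)) = μ.withDensity q := by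
  obtain ⟨hpm, hp1⟩ := hp
  obtain ⟨hqm, hq1⟩ := hq
  set r : E → ℝ := fun x => (q x / (p x + q x)).toReal with hr
  have hrm : Measurable r := (hqm.div (hpm.add hqm)).ennreal_toReal
  have hle : ∀ x, q x / (p x + q x) ≤ 1 := fun x => ENNReal.div_le_of_le_mul (by simp)
  have hne : ∀ x, q x / (p x + q x) ≠ ∞ := fun x => ((hle x).trans_lt ENNReal.one_lt_top).ne
  have hof : ∀ x, ENNReal.ofReal (r x) = q x / (p x + q x) := fun x => ENNReal.ofReal_toReal (hne x)
  have hmem : ∀ x, r x ∈ Set.Icc (0 : ℝ) 1 := fun x =>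
    ⟨ENNReal.toReal_nonneg, ENNReal.toReal_le_of_le_ofReal zero_le_one (by simpa using hle x)⟩
  have hof' : ∀ x, ENNReal.ofReal (1 - r x) = 1 - q x / (p x + q x) := fun x => by
    rw [ENNReal.ofReal_sub _ (hmem x).1, hof, ENNReal.ofReal_one]
  have hpf : ∀ᵐ x ∂μ, p x < ∞ := ae_lt_top hpm (by rw [hp1]; exact ENNReal.one_ne_top)
  have hqf : ∀ᵐ x ∂μ, q x < ∞ := ae_lt_top hqm (by rw [hq1]; exact ENNReal.one_ne_top)
  have e1 : (μ.withDensity (p + q)).withDensity (fun x => ENNReal.ofReal (1 - r x)) =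
      μ.withDensity p := by
    rw [← withDensity_mul _ (hpm.add hqm) (by fun_prop)]
    refine withDensity_congr_ae ?_
    filter_upwards [hpf, hqf] with x h1 h2
    simp only [Pi.mul_apply, Pi.add_apply, hof']
    by_cases h0 : p x + q x = 0
    · rw [h0, zero_mul, (add_eq_zero.1 h0).1]
    · have hs : p x + q x ≠ ∞ := (ENNReal.add_lt_top.2 ⟨h1, h2⟩).ne
      rw [ENNReal.mul_sub fun _ _ => hs, mul_one, ENNReal.mul_div_cancel h0 hs,
        ENNReal.add_sub_cancel_right h2.ne]
  have e2 : (μ.withDensity (p + q)).withDensity (fun x => ENNReal.ofReal (r x)) =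
      μ.withDensity q := by
    rw [← withDensity_mul _ (hpm.add hqm) (by fun_prop)]
    refine withDensity_congr_ae ?_
    filter_upwards [hpf, hqf] with x h1 h2
    simp only [Pi.mul_apply, Pi.add_apply, hof]
    by_cases h0 : p x + q x = 0
    · rw [h0, zero_mul, (add_eq_zero.1 h0).2]
    · exact ENNReal.mul_div_cancel h0 (ENNReal.add_lt_top.2 ⟨h1, h2⟩).ne
  refine ⟨μ.withDensity (p + q), r, ⟨hrm, hmem, ?_, ?_⟩, e1, e2⟩
  · rw [← setLIntegral_univ, ← withDensity_apply _ MeasurableSet.univ, e2,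
      withDensity_apply _ MeasurableSet.univ, setLIntegral_univ, hq1]
  · rw [← setLIntegral_univ, ← withDensity_apply _ MeasurableSet.univ, e1,
      withDensity_apply _ MeasurableSet.univ, setLIntegral_univ, hp1]

/-- The stream `k₀` is needed because the common functions are known to be densities only through an
actual stream. -/
theorem IsModelMs.exists_isRatioModel {Ω : Type*} [MeasurableSpace Ω] {K : ℕ} {P : Measure Ω}
    {μ : Measure E} {p q : Fin K → ℕ → E → ℝ≥0∞} {τ : Fin K → Ω → ℕ∞} {X : Fin K → ℕ → Ω → E}
    {θ : ℝ} (h : IsModelMs P μ p q τ X θ) (k₀ : Fin K) :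
    ∃ (ν : Measure E) (r : E → ℝ), IsRatioModel P ν r τ X θ := by
  obtain ⟨p₀, hp₀⟩ := h.homogeneous_pre
  obtain ⟨q₀, hq₀⟩ := h.homogeneous_post
  obtain ⟨ν, r, hr, e1, e2⟩ := exists_isRatio (hp₀ k₀ 1 le_rfl ▸ h.density_pre k₀ 1 le_rfl)
    (hq₀ k₀ 1 le_rfl ▸ h.density_post k₀ 1 le_rfl)
  refine ⟨ν, r, h.theta_mem, hr, h.measurable_changePoint, h.measurable_obs, h.indep, h.geometric,
    fun m n B hB => ?_⟩
  refine (h.joint_law m n B hB).trans ?_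
  congr 1
  refine Finset.prod_congr rfl fun k _ => Finset.prod_congr rfl fun t ht => ?_
  have ht1 := (Finset.mem_Icc.1 ht).1
  rw [hp₀ k t ht1, hq₀ k t ht1, obsLaw, obsLaw, e1, e2]

end Ratio

end CompoundDetection

theorem theorem5 {Ω E : Type*} [MeasurableSpace Ω] [MeasurableSpace E] {K : ℕ}
    (P : Measure Ω) [IsProbabilityMeasure P] (μ : Measure E)
    (p q : Fin K → ℕ → E → ℝ≥0∞) (τ : Fin K → Ω → ℕ∞) (X : Fin K → ℕ → Ω → E)
    (hmodel : CompoundDetection.IsChangePointModel P μ p q τ X)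
    (α : ℝ) (hα : α ∈ Set.Ioc (0 : ℝ) 1)
    (A : ℕ → Ω → Finset (Fin K)) (hA : A ∈ CompoundDetection.procedureClass P τ X α) (t₀ : ℕ) :
    CompoundDetection.switching P τ X α A t₀ ∈ CompoundDetection.procedureClass P τ X α ∧
    CompoundDetection.switching P τ X α A (t₀ + 1) ∈ CompoundDetection.procedureClass P τ X α ∧
    ∀ θ : ℝ, CompoundDetection.IsModelMs P μ p q τ X θ →
      ∀ t : ℕ, 1 ≤ t →
        ∫ ω, CompoundDetection.utilization A t ω ∂P ≤
            ∫ ω, CompoundDetection.utilization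
              (CompoundDetection.switching P τ X α A (t₀ + 1)) t ω ∂P ∧
        ∫ ω, CompoundDetection.utilization
              (CompoundDetection.switching P τ X α A (t₀ + 1)) t ω ∂P ≤
            ∫ ω, CompoundDetection.utilization
              (CompoundDetection.switching P τ X α A t₀) t ω ∂P ∧
        ∫ ω, CompoundDetection.utilization
              (CompoundDetection.switching P τ X α A t₀) t ω ∂P ≤
            ∫ ω, CompoundDetection.utilization (CompoundDetection.proposed P τ X α) t ω ∂P := by
  have hτ := hmodel.measurable_changePoint
  have hX := hmodel.measurable_obs
  have hα₀ : 0 ≤ α := hα.1.le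
  refine ⟨CompoundDetection.switching_mem_procedureClass hτ hX hα₀ hA t₀,
    CompoundDetection.switching_mem_procedureClass hτ hX hα₀ hA (t₀ + 1), fun θ hM t _ => ?_⟩
  rcases isEmpty_or_nonempty (Fin K) with hK | ⟨⟨k₀⟩⟩
  · simp [CompoundDetection.utilization, Finset.eq_empty_of_isEmpty]
  obtain ⟨ν, r, hR⟩ := hM.exists_isRatioModel k₀
  have hanti : ∀ s, 1 ≤ s → Antitone fun n =>
      ∫⁻ ω, ((CompoundDetection.switching P τ X α A n s ω).card : ℝ≥0∞) ∂P := fun s hs =>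
    antitone_nat_of_succ_le fun n => hR.lintegral_card_switching_succ_le hα₀ hA hs n
  have hproc := CompoundDetection.isProcedure_switching (P := P) (τ := τ) hA.1 α
  refine ⟨?_, ?_, ?_⟩
  · refine CompoundDetection.integral_utilization_mono hX hA.1 (hproc _) (fun s hs => ?_) t
    -- At time `s`, `A` is the procedure switching at `max s (t₀ + 1)`, so antitonicity in the
    -- switching time applies to it as well.
    rw [← CompoundDetection.switching_of_le (P := P) (τ := τ) (α := α) hA.1 hs
      (le_max_left s (t₀ + 1))]
    exact hanti s hs (le_max_right s (t₀ + 1))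
  · exact CompoundDetection.integral_utilization_mono hX (hproc _) (hproc _)
      (fun s hs => hanti s hs (Nat.le_succ t₀)) t
  · have h0 : CompoundDetection.proposed P τ X α = CompoundDetection.switching P τ X α A 0 :=
      funext fun s => (CompoundDetection.switching_zero_eq_proposed s).symm
    rw [h0]
    exact CompoundDetection.integral_utilization_mono hX (hproc _) (hproc _)
      (fun s hs => hanti s hs (Nat.zero_le t₀)) t
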